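/- Let $\mathbb T^2=\mathbb R^2/\mathbb Z^2$, let $e_m(x)=e^{2\pi i m\cdot x}$ for $m\in\mathbb Z^2$ (these are the characters $e^{im\cdot x}$ of $\mathbb R^2/(2\pi\mathbb Z)^2$ after rescaling the space variable), let $\widehat f(m)$ be the Fourier coefficients of $f$, and let $\langle m\rangle=(1+m_1^2+m_2^2)^{1/2}$. Let $s\in(0,1)$ and let $f\in L^2(\mathbb T^2)$ be complex-valued. Put $$\sigma^1_m(f)=\widehat f(m_1+1,m_2)-\widehat f(m_1,m_2),\qquad \sigma^2_m(f)=\widehat f(m_1,m_2+1)-\widehat f(m_1,m_2),$$ $$\sigma_m(f)=\widehat f(m_1+1,m_2+1)-\widehat f(m_1+1,m_2)-\widehat f(m_1,m_2+1)+\widehat f(m_1,m_2),$$ and suppose that there is a constant $C$ such that for all $m\in\mathbb Z^2$ and $i\in\{1,2\}$ $$|\widehat f(m)|\le C\langle m\rangle^{-1-s},\qquad |\sigma^i_m(f)|\le C\langle m\rangle^{-2-s},\qquad |\sigma_m(f)|\le C\langle m\rangle^{-3-s}.$$ For $t\in\mathbb R$ let $u(\cdot,t)=\sum_{m\in\mathbb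 Z^2}e^{i|m|^2t}\widehat f(m)e_m$, the series converging in $L^2(\mathbb T^2)$. Whenever $u(\cdot,t)$ has a (necessarily unique) continuous representative, let $\dim_t(f)$ be the maximum of the upper box dimensions of the graphs of the real and the imaginary part of this representative, where the upper box dimension of a bounded set $E$ is $\limsup_{\varepsilon\to0+}\log\mathcal N(E,\varepsilon)/\log(1/\varepsilon)$, with $\mathcal N(E,\varepsilon)$ the minimum number of boxes of side length $\varepsilon$ needed to cover $E$. Let $H^r$ be the space of those $g\in L^2(\mathbb T^2)$ with $\sum_m\langle m\rangle^{2r}|\widehat g(m)|^2<\infty$, and let $r_0=\sup\{r\in\mathbb R: f\in H^r\}\in[-\infty,\infty]$. (i) For almost every $t$, $u(\cdot,t)$ has a continuous representative, it is Hölder continuous of every order $\gamma<s$, and $\dim_t(f)\le 3-s$. (ii) For almost every $t$, if $u(\cdot,t)$ has a continuous representative, then $\dim_t(f)\ge 3+s-2r_0$. In particular, if $s=\tfrac12$ and $f\notin H^{1/2}$, then for almost every $t$, $u(\cdot,t)$ has a continuous representative and $\dim_t(f)=\tfrac52$. -/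

import Mathlib

open MeasureTheory Filter Topology
open scoped NNReal ENNReal

noncomputable section

/-- The two-dimensional torus, as `(ℝ/ℤ)²`; the `m`-th character is `UnitAddTorus.mFourier m`. -/
abbrev Torus2 : Type := UnitAddTorus (Fin 2)

/-- The normalised Haar measure on the torus, the one that `UnitAddTorus.mFourierCoeff` uses. -/
abbrev torusMeasure : Measure Torus2 := Measure.pi fun _ => AddCircle.haarAddCircle

/-- `|m|² = m₁² + m₂²`. -/
def latticeNormSq (m : Fin 2 → ℤ) : ℝ := (m 0 : ℝ) ^ 2 + (m 1 : ℝ) ^ 2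

/-- The bracket `⟨m⟩ = (1 + |m|²)^{1/2}`. -/
def bracket (m : Fin 2 → ℤ) : ℝ := Real.sqrt (1 + latticeNormSq m)

/-- The first difference of the Fourier coefficients in the first direction. -/
def diffFst (f : Torus2 → ℂ) (m : Fin 2 → ℤ) : ℂ :=
  UnitAddTorus.mFourierCoeff f ![m 0 + 1, m 1] - UnitAddTorus.mFourierCoeff f m

/-- The first difference of the Fourier coefficients in the second direction. -/
def diffSnd (f : Torus2 → ℂ) (m : Fin 2 → ℤ) : ℂ :=
  UnitAddTorus.mFourierCoeff f ![m 0, m 1 + 1] - UnitAddTorus.mFourierCoeff f m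

/-- The mixed second difference of the Fourier coefficients. -/
def diffMixed (f : Torus2 → ℂ) (m : Fin 2 → ℤ) : ℂ :=
  UnitAddTorus.mFourierCoeff f ![m 0 + 1, m 1 + 1] - UnitAddTorus.mFourierCoeff f ![m 0 + 1, m 1]
    - UnitAddTorus.mFourierCoeff f ![m 0, m 1 + 1] + UnitAddTorus.mFourierCoeff f m

/-- The `L²` function `u(·, t) = ∑ₘ e^{i|m|²t} f̂(m) e_m`, the series being summed in `L²`. -/
def schrodingerFlow (f : Torus2 → ℂ) (t : ℝ) : Lp ℂ 2 torusMeasure :=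
  ∑' m : Fin 2 → ℤ,
    (Complex.exp (Complex.I * ((latticeNormSq m * t : ℝ) : ℂ)) * UnitAddTorus.mFourierCoeff f m) •
      ContinuousMap.toLp 2 torusMeasure ℂ (UnitAddTorus.mFourier m)

/-- `f ∈ H^r`, for `f ∈ L²`: the sum of `⟨m⟩^{2r} |f̂(m)|²` is finite. -/
def MemH (f : Torus2 → ℂ) (r : ℝ) : Prop :=
  Summable fun m : Fin 2 → ℤ => bracket m ^ (2 * r) * ‖UnitAddTorus.mFourierCoeff f m‖ ^ 2

/-- The Sobolev index `sup {r : f ∈ H^r}`, possibly `+∞`. -/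
def sobolevIndex (f : Torus2 → ℂ) : EReal := sSup ((fun r : ℝ => (r : EReal)) '' {r | MemH f r})

/-- The upper box dimension `limsup_{ε → 0+} log N(E, ε) / log (1/ε)`, where `N(E, ε)` is the
minimum number of closed balls of radius `ε/2` that cover `E`; in the sup metric that the products
`Torus2` and `Torus2 × ℝ` carry, these balls are the boxes of side length `ε`. -/
def upperBoxDim {X : Type*} [PseudoEMetricSpace X] (E : Set X) : EReal :=
  limsup (fun ε : ℝ≥0 =>
    ENNReal.log ((Metric.externalCoveringNumber (ε / 2) E : ℕ∞) : ℝ≥0∞) /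
      ((Real.log (1 / (ε : ℝ)) : ℝ) : EReal)) (𝓝[>] 0)

/-- The maximum of the upper box dimensions of the graphs of the real and imaginary parts of `v`. -/
def graphDim (v : Torus2 → ℂ) : EReal :=
  max (upperBoxDim (Set.graphOn (fun x => (v x).re) Set.univ))
    (upperBoxDim (Set.graphOn (fun x => (v x).im) Set.univ))

end

/-! The flow factors over the two coordinates into quadratic exponential sums. Weyl differencing
turns the square of a sum of length k into geometric sums with ratios e^{2iht}, and the sum over h
of h^{-1-δ}|1 - e^{2iht}|^{-(1-δ)} is finite for almost every t: the function |1 - e^{2iθ}|^{-(1-δ)}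
is integrable on ℝ/πℤ, and θ ↦ hθ preserves the measure. Hence almost every t admits the bound
O(k^{1/2+δ}), uniformly in x and in the position of the interval (`ae_norm_sum_gaussWeight_le`).

Upper bound. Abel summation in both variables bounds the dyadic shell at frequency N by N^{-1-s}
N^{1+2δ} = N^{2δ-s}, and its γ-Hölder constant by N^{γ+2δ-s}. Summing over dyadic N gives a uniform
limit that is Hölder of every order γ < s (`CoeffDecay.exists_tendsto_flowSum`), and such a graph
has dimension at most 3 - s.

Lower bound. If about ε^{-D} boxes cover the graph of g, the intermediate value theorem shows that
translation by ε along an axis changes g by O(ε^{3-D}) in L¹ (`lintegral_enorm_sub_le_of_isCover`).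
Multiplying by the Hölder bound ε^γ gives the squared L² modulus, and Parseval at ε = 1/(4N) shows
that the shell at N carries O(N^{-(γ+3-D)}) of the ℓ² mass. The flow preserves the moduli of Fourier
coefficients, so f lies in H^r for all 2r < s + 3 - D, which forces D ≥ 3 + s - 2r₀. -/

/-! ### Abel summation in one and two variables -/

/-- Abel summation against a weight with bounded partial sums. -/
theorem norm_sum_mul_le_of_partial_sums {A w : ℕ → ℂ} {a d W : ℝ} {k : ℕ} (hd0 : 0 ≤ d)
    (hW : ∀ j ≤ k, ‖∑ n ∈ Finset.range j, w n‖ ≤ W) (hA : ∀ n < k, ‖A n‖ ≤ a)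
    (hd : ∀ n < k, ‖A (n + 1) - A n‖ ≤ d) (hkd : k * d ≤ a) :
    ‖∑ n ∈ Finset.range k, A n * w n‖ ≤ 2 * a * W := by
  have hW0 : 0 ≤ W := (norm_nonneg _).trans (hW 0 (Nat.zero_le _))
  have ha0 : 0 ≤ a := le_trans (by positivity) hkd
  rcases Nat.eq_zero_or_pos k with rfl | hk
  · simp; positivity
  have := Finset.sum_range_by_parts A w k
  simp only [smul_eq_mul] at this
  rw [this]
  refine (norm_sub_le _ _).trans ?_
  have h1 : ‖A (k - 1) * ∑ i ∈ Finset.range k, w i‖ ≤ a * W := by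
    rw [norm_mul]
    exact mul_le_mul (hA _ (by omega)) (hW k le_rfl) (norm_nonneg _) ha0
  have h2 : ‖∑ i ∈ Finset.range (k - 1), (A (i + 1) - A i) * ∑ j ∈ Finset.range (i + 1), w j‖
      ≤ a * W := by
    refine (norm_sum_le _ _).trans ((Finset.sum_le_card_nsmul _ _ (d * W) ?_).trans ?_)
    · intro i hi
      rw [Finset.mem_range] at hi
      rw [norm_mul]
      exact mul_le_mul (hd _ (by omega)) (hW _ (by omega)) (norm_nonneg _) hd0
    · rw [Finset.card_range, nsmul_eq_mul, ← mul_assoc]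
      refine mul_le_mul_of_nonneg_right (le_trans ?_ hkd) hW0
      gcongr
      omega
  linarith

/-- Two-dimensional Abel summation against a product weight. -/
theorem norm_sum_sum_mul_le_of_partial_sums {A : ℕ → ℕ → ℂ} {w₁ w₂ : ℕ → ℂ} {a L W₁ W₂ : ℝ}
    {k₁ k₂ : ℕ} (hL : 0 < L) (hk₁ : k₁ ≤ L) (hk₂ : k₂ ≤ L) (ha : 0 ≤ a)
    (hW₁ : ∀ j ≤ k₁, ‖∑ n ∈ Finset.range j, w₁ n‖ ≤ W₁)
    (hW₂ : ∀ j ≤ k₂, ‖∑ n ∈ Finset.range j, w₂ n‖ ≤ W₂)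
    (hA : ∀ p < k₁, ∀ q < k₂, ‖A p q‖ ≤ a)
    (hA₁ : ∀ p < k₁, ∀ q < k₂, ‖A (p + 1) q - A p q‖ ≤ a / L)
    (hA₂ : ∀ p < k₁, ∀ q < k₂, ‖A p (q + 1) - A p q‖ ≤ a / L)
    (hA₁₂ : ∀ p < k₁, ∀ q < k₂,
      ‖A (p + 1) (q + 1) - A (p + 1) q - A p (q + 1) + A p q‖ ≤ a / L ^ 2) :
    ‖∑ q ∈ Finset.range k₂, (∑ p ∈ Finset.range k₁, A p q * w₁ p) * w₂ q‖ ≤ 4 * a * W₁ * W₂ := by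
  have hW0 : 0 ≤ W₁ := (norm_nonneg _).trans (hW₁ 0 (Nat.zero_le _))
  have key : ∀ (k : ℕ) (b : ℝ), k ≤ L → 0 ≤ b → k * (b / L) ≤ b := by
    intro k b hk hb
    rw [mul_div_assoc', div_le_iff₀ hL]
    nlinarith
  -- The inner sum serves as the coefficient of `w₂ q`. Abel summation in p bounds it by 2aW₁, and
  -- bounds its q-difference by 2(a/L)W₁ through the mixed second difference of `A`.
  have := norm_sum_mul_le_of_partial_sums (A := fun q => ∑ p ∈ Finset.range k₁, A p q * w₁ p)
    (w := w₂) (a := 2 * a * W₁) (d := 2 * (a / L) * W₁) (k := k₂) (by positivity) hW₂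
    (fun q hq => norm_sum_mul_le_of_partial_sums (d := a / L) (by positivity) hW₁
      (fun p hp => hA p hp q hq) (fun p hp => hA₁ p hp q hq) (key _ _ hk₁ ha))
    (fun q hq => by
      rw [← Finset.sum_sub_distrib]
      simp only [← sub_mul]
      refine norm_sum_mul_le_of_partial_sums (A := fun p => A p (q + 1) - A p q)
        (d := a / L / L) (by positivity) hW₁
        (fun p hp => hA₂ p hp q hq) (fun p hp => ?_) (key _ _ hk₁ (by positivity))
      have := hA₁₂ p hp q hq
      rw [div_div, ← sq]
      convert this using 2
      ring)
    (by
      have := key k₂ (2 * a * W₁) hk₂ (by positivity)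
      calc (k₂ : ℝ) * (2 * (a / L) * W₁) = k₂ * (2 * a * W₁ / L) := by ring
        _ ≤ _ := this)
  linarith

/-! ### Weyl's estimate at almost every time -/

/-- The identity behind Weyl differencing. -/
theorem normSq_sum_range_eq (w : ℕ → ℂ) (k : ℕ) :
    ‖∑ n ∈ Finset.range k, w n‖ ^ 2 = ∑ n ∈ Finset.range k, ‖w n‖ ^ 2 +
      2 * (∑ h ∈ Finset.range k, ∑ n ∈ Finset.range (k - 1 - h),
        w (n + h + 1) * (starRingEnd ℂ) (w n)).re := by
  induction k with
  | zero => simp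
  | succ k ih =>
    -- The index h stands for the lag h + 1. Passing from k to k + 1 adds to each lag the single
    -- product with n = k - 1 - h, so the new terms are the reflected sum of `w k` times the
    -- conjugates of all earlier weights.
    have e : ∑ h ∈ Finset.range (k + 1), ∑ n ∈ Finset.range (k + 1 - 1 - h),
        w (n + h + 1) * (starRingEnd ℂ) (w n) =
        ∑ h ∈ Finset.range k, ∑ n ∈ Finset.range (k - 1 - h),
        w (n + h + 1) * (starRingEnd ℂ) (w n)
        + w k * (starRingEnd ℂ) (∑ n ∈ Finset.range k, w n) := by
      rw [Finset.sum_range_succ, map_sum, Finset.mul_sum]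
      simp only [Nat.add_sub_cancel, Nat.sub_self, Finset.range_zero, Finset.sum_empty, add_zero]
      rw [← Finset.sum_range_reflect (fun n => w k * (starRingEnd ℂ) (w n)),
        ← Finset.sum_add_distrib]
      refine Finset.sum_congr rfl fun h hh => ?_
      rw [Finset.mem_range] at hh
      have e1 : k - h = (k - 1 - h) + 1 := by omega
      have e2 : k - 1 - h + h + 1 = k := by omega
      rw [e1, Finset.sum_range_succ, e2]
    rw [Finset.sum_range_succ, Finset.sum_range_succ, e, ← Complex.normSq_eq_norm_sq,
      Complex.normSq_add, Complex.normSq_eq_norm_sq, Complex.normSq_eq_norm_sq, ih,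
      Complex.add_re]
    have : (w k * (starRingEnd ℂ) (∑ n ∈ Finset.range k, w n)).re
      = ((∑ n ∈ Finset.range k, w n) * (starRingEnd ℂ) (w k)).re := by
      simp only [Complex.mul_re, Complex.conj_re, Complex.conj_im]; ring
    rw [this]
    ring

/-- A geometric sum, interpolated between its two standard bounds. -/
theorem norm_geom_sum_le {q : ℂ} (hq : ‖q‖ = 1) (hq1 : q ≠ 1) {δ : ℝ} (hδ0 : 0 ≤ δ) (hδ1 : δ ≤ 1)
    (n : ℕ) :
    ‖∑ i ∈ Finset.range n, q ^ i‖ ≤ (n : ℝ) ^ δ * (2 * ‖1 - q‖ ^ (-(1 - δ))) := by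
  have hpos : 0 < ‖1 - q‖ := norm_pos_iff.2 (sub_ne_zero.2 hq1.symm)
  set X := ‖∑ i ∈ Finset.range n, q ^ i‖ with hX
  have h1 : X ≤ n := by
    refine (norm_sum_le _ _).trans ?_
    simp [hq]
  have h2 : X ≤ 2 * ‖1 - q‖⁻¹ := by
    rw [hX, geom_sum_eq hq1, norm_div, div_eq_mul_inv, norm_sub_rev q 1]
    gcongr
    calc ‖q ^ n - 1‖ ≤ ‖q ^ n‖ + ‖(1 : ℂ)‖ := norm_sub_le _ _
      _ = 2 := by rw [norm_pow, hq]; norm_num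
  have hX0 : 0 ≤ X := norm_nonneg _
  calc X = X ^ δ * X ^ (1 - δ) := by
        rw [← Real.rpow_add_of_nonneg hX0 hδ0 (by linarith)]; simp
    _ ≤ (n : ℝ) ^ δ * (2 * ‖1 - q‖⁻¹) ^ (1 - δ) := by gcongr
    _ = (n : ℝ) ^ δ * (2 ^ (1 - δ) * ‖1 - q‖ ^ (-(1 - δ))) := by
        rw [Real.mul_rpow (by norm_num) (by positivity), Real.inv_rpow hpos.le,
          Real.rpow_neg hpos.le]
    _ ≤ _ := by
        gcongr
        calc (2 : ℝ) ^ (1 - δ) ≤ 2 ^ (1 : ℝ) :=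
              Real.rpow_le_rpow_of_exponent_le (by norm_num) (by linarith)
          _ = 2 := by norm_num

/-- On the circle of length π the first character is e^{2iθ}, the ratio met in Weyl differencing.
There |1 - e^{2iθ}| = 2|sin θ| ≥ |θ| for |θ| ≤ π/2, and |θ|^{-(1-δ)} is integrable at 0. -/
theorem lintegral_one_sub_fourier_rpow_lt_top [Fact (0 < Real.pi)] {δ : ℝ} (hδ0 : 0 < δ)
    (hδ1 : δ < 1) :
    ∫⁻ θ : AddCircle Real.pi, ‖1 - fourier 1 θ‖ₑ ^ (-(1 - δ)) < ∞ := by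
  rw [← AddCircle.lintegral_preimage Real.pi (-(Real.pi / 2))]
  have hint : IntervalIntegrable (fun x : ℝ => (x : ℂ) ^ ((-(1 - δ) : ℝ) : ℂ)) volume
      (-(Real.pi / 2)) (-(Real.pi / 2) + Real.pi) :=
    intervalIntegral.intervalIntegrable_cpow' (by simpa using hδ0)
  rw [intervalIntegrable_iff_integrableOn_Ioc_of_le (by linarith [Real.pi_pos])] at hint
  refine lt_of_le_of_lt (lintegral_mono_ae ?_) hint.2
  -- The origin must be removed: there the integrand is ∞, while the majorant, a power of 0, takes
  -- the value 0.
  have h0 : ∀ᵐ t : ℝ ∂volume.restrict (Set.Ioc (-(Real.pi / 2)) (-(Real.pi / 2) + Real.pi)),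
      t ≠ 0 := ae_restrict_of_ae (Measure.ae_ne volume 0)
  filter_upwards [h0, ae_restrict_mem measurableSet_Ioc] with t ht htI
  have e : ‖1 - fourier 1 (t : AddCircle Real.pi)‖ = 2 * |Real.sin t| := by
    have h1 : (2 * Real.pi * Complex.I * (1 : ℤ) * t / Real.pi : ℂ)
        = Complex.I * ((2 * t : ℝ) : ℂ) := by
      have : (Real.pi : ℂ) ≠ 0 := by exact_mod_cast Real.pi_ne_zero
      push_cast
      field_simp
    rw [norm_sub_rev, fourier_coe_apply, h1, Complex.norm_exp_I_mul_ofReal_sub_one]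
    simp
  have h2 : |t| ≤ 2 * |Real.sin t| := by
    have := Real.mul_abs_le_abs_sin (x := t) (abs_le.2 ⟨by linarith [htI.1], by linarith [htI.2]⟩)
    have h3 : (1 : ℝ) / 2 ≤ 2 / Real.pi := by
      rw [div_le_div_iff₀ (by norm_num) Real.pi_pos]; linarith [Real.pi_le_four]
    nlinarith [abs_nonneg t]
  have ht' : 0 < |t| := abs_pos.2 ht
  rw [← ofReal_norm, ← ofReal_norm, Complex.norm_cpow_real, Complex.norm_real, e,
    ENNReal.ofReal_rpow_of_pos (ht'.trans_le h2)]
  exact ENNReal.ofReal_le_ofReal (Real.rpow_le_rpow_of_nonpos ht' h2 (by linarith))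

/-- For almost every `θ`, a weighted sum over all multiples of `θ` of a negative power of the
distance to the origin converges. -/
theorem ae_tsum_one_sub_fourier_rpow_lt_top [Fact (0 < Real.pi)] {δ : ℝ} (hδ0 : 0 < δ)
    (hδ1 : δ < 1) :
    ∀ᵐ θ : AddCircle Real.pi, ∑' h : ℕ, ENNReal.ofReal (((h : ℝ) + 1) ^ (-(1 + δ))) *
      ‖1 - fourier 1 ((h + 1) • θ)‖ₑ ^ (-(1 - δ)) < ∞ := by
  have hmeas : Measurable fun θ : AddCircle Real.pi => ‖1 - fourier 1 θ‖ₑ ^ (-(1 - δ)) := by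
    fun_prop
  refine ae_lt_top (Measurable.tsum fun h => ?_) ?_
  · fun_prop
  rw [lintegral_tsum (fun h => by fun_prop)]
  have : ∀ h : ℕ, ∫⁻ θ : AddCircle Real.pi, ENNReal.ofReal (((h : ℝ) + 1) ^ (-(1 + δ))) *
      ‖1 - fourier 1 ((h + 1) • θ)‖ₑ ^ (-(1 - δ)) = ENNReal.ofReal (((h : ℝ) + 1) ^ (-(1 + δ))) *
      ∫⁻ θ : AddCircle Real.pi, ‖1 - fourier 1 θ‖ₑ ^ (-(1 - δ)) := by
    intro h
    rw [lintegral_const_mul _ (by fun_prop)]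
    congr 1
    -- Multiplication by a nonzero integer preserves Haar measure, so every term has the same
    -- integral up to its summable weight.
    · have := (Measure.measurePreserving_zsmul (volume : Measure (AddCircle Real.pi))
        (show ((h + 1 : ℕ) : ℤ) ≠ 0 by positivity)).lintegral_comp hmeas
      simpa only [natCast_zsmul] using this
  simp_rw [this]
  rw [ENNReal.tsum_mul_right]
  refine ENNReal.mul_ne_top ?_ (lintegral_one_sub_fourier_rpow_lt_top hδ0 hδ1).ne
  have hs : Summable fun h : ℕ => ((h : ℝ) + 1) ^ (-(1 + δ)) := by
    have := (summable_nat_add_iff 1).2 (Real.summable_nat_rpow.2 (show -(1 + δ) < -1 by linarith))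
    simpa using this
  exact hs.tsum_ofReal_ne_top

/-- A property that holds almost everywhere on the circle holds almost everywhere on the line. -/
theorem AddCircle.ae_coe_of_ae {T : ℝ} [hT : Fact (0 < T)] {p : AddCircle T → Prop}
    (hp : ∀ᵐ θ : AddCircle T, p θ) : ∀ᵐ t : ℝ, p t := by
  have h : ∀ n : ℤ, ∀ᵐ t : ℝ ∂(volume : Measure ℝ).restrict (Set.Ioc (n • T) ((n + 1) • T)),
      p (t : AddCircle T) := by
    intro n
    rw [add_smul, one_smul]
    exact (AddCircle.measurePreserving_mk T (n • T)).quasiMeasurePreserving.ae hp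
  have := (ae_restrict_iUnion_iff (μ := (volume : Measure ℝ)) _ _).2 h
  rwa [iUnion_Ioc_zsmul hT.out, Measure.restrict_univ] at this

/-- The summands of the one-dimensional periodic Schrödinger flow of the delta function. -/
noncomputable def gaussWeight (t : ℝ) (x : UnitAddCircle) (n : ℤ) : ℂ :=
  Complex.exp (Complex.I * (((n : ℝ) ^ 2 * t : ℝ) : ℂ)) * fourier n x

theorem norm_gaussWeight (t : ℝ) (x : UnitAddCircle) (n : ℤ) : ‖gaussWeight t x n‖ = 1 := by
  rw [gaussWeight, norm_mul, mul_comm Complex.I, Complex.norm_exp_ofReal_mul_I, one_mul,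
    fourier_apply, Circle.norm_coe]

/-- Since (n + h)² - n² = h² + 2hn, the correlation at a fixed lag is a geometric progression in n,
and its ratio does not depend on x. -/
theorem gaussWeight_mul_conj (t : ℝ) (x : UnitAddCircle) (n h : ℤ) :
    gaussWeight t x (n + h) * (starRingEnd ℂ) (gaussWeight t x n) =
      gaussWeight t x h * Complex.exp (2 * Complex.I * h * n * t) := by
  simp only [gaussWeight, map_mul, ← fourier_neg]
  rw [mul_mul_mul_comm, ← fourier_add, ← Complex.exp_conj, ← Complex.exp_add, mul_right_comm,
    ← Complex.exp_add]
  congr 2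
  · simp only [map_mul, Complex.conj_I, Complex.conj_ofReal]
    push_cast
    ring
  · ring_nf

/-- Weyl's estimate for quadratic exponential sums at almost every time, uniformly over
intervals of given length. -/
theorem ae_norm_sum_gaussWeight_le {δ : ℝ} (hδ0 : 0 < δ) (hδ1 : δ < 1) :
    ∀ᵐ t : ℝ, ∃ G : ℝ, 0 ≤ G ∧ ∀ (a : ℤ) (k : ℕ) (x : UnitAddCircle),
      ‖∑ n ∈ Finset.range k, gaussWeight t x (a + n)‖ ≤ G * (k : ℝ) ^ (1 / 2 + δ) := by
  have : Fact (0 < Real.pi) := ⟨Real.pi_pos⟩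
  filter_upwards [AddCircle.ae_coe_of_ae (ae_tsum_one_sub_fourier_rpow_lt_top hδ0 hδ1)] with t ht
  set q : ℕ → ℂ := fun h => Complex.exp (2 * Complex.I * (h + 1) * t) with hq
  have hfq : ∀ h : ℕ, fourier 1 ((h + 1) • (t : AddCircle Real.pi)) = q h := by
    intro h
    have hpi : (Real.pi : ℂ) ≠ 0 := by exact_mod_cast Real.pi_ne_zero
    rw [← AddCircle.coe_nsmul, fourier_coe_apply, hq]
    congr 1
    push_cast
    simp only [nsmul_eq_mul]
    push_cast
    field_simp
  simp only [hfq] at ht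
  have hpos : ∀ h : ℕ, 0 < ((h : ℝ) + 1) ^ (-(1 + δ)) := fun h => by positivity
  -- A ratio equal to 1 would contribute a positive weight times ∞ to a finite series.
  have hq1 : ∀ h, q h ≠ 1 := by
    intro h hh
    have h1 := ENNReal.ne_top_of_tsum_ne_top ht.ne h
    rw [hh, sub_self, enorm_zero, ENNReal.zero_rpow_of_neg (by linarith), ENNReal.mul_top] at h1
    · exact h1 rfl
    · exact (ENNReal.ofReal_pos.2 (hpos h)).ne'
  have hterm : ∀ h : ℕ, ENNReal.ofReal (((h : ℝ) + 1) ^ (-(1 + δ))) * ‖1 - q h‖ₑ ^ (-(1 - δ))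
      = ENNReal.ofReal (((h : ℝ) + 1) ^ (-(1 + δ)) * ‖1 - q h‖ ^ (-(1 - δ))) := by
    intro h
    rw [ENNReal.ofReal_mul (hpos h).le, ← ofReal_norm, ENNReal.ofReal_rpow_of_pos]
    exact norm_pos_iff.2 (sub_ne_zero.2 (hq1 h).symm)
  simp only [hterm] at ht
  have hnn : ∀ h : ℕ, 0 ≤ ((h : ℝ) + 1) ^ (-(1 + δ)) * ‖1 - q h‖ ^ (-(1 - δ)) := by
    intro h; positivity
  have hsum : Summable fun h : ℕ => ((h : ℝ) + 1) ^ (-(1 + δ)) * ‖1 - q h‖ ^ (-(1 - δ)) := by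
    refine (ENNReal.summable_toReal ht.ne).congr fun h => ?_
    rw [ENNReal.toReal_ofReal (hnn h)]
  set F := ∑' h : ℕ, ((h : ℝ) + 1) ^ (-(1 + δ)) * ‖1 - q h‖ ^ (-(1 - δ)) with hF
  have hF0 : 0 ≤ F := tsum_nonneg hnn
  -- For h < k the weight (h + 1)^{-(1+δ)} is at least k^{-(1+δ)}, so it can be inserted at the cost
  -- of k^{1+δ}.
  have hφ : ∀ k : ℕ, ∑ h ∈ Finset.range k, ‖1 - q h‖ ^ (-(1 - δ)) ≤ (k : ℝ) ^ (1 + δ) * F := by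
    intro k
    calc _ ≤ ∑ h ∈ Finset.range k, (k : ℝ) ^ (1 + δ) *
          (((h : ℝ) + 1) ^ (-(1 + δ)) * ‖1 - q h‖ ^ (-(1 - δ))) := by
          refine Finset.sum_le_sum fun h hh => ?_
          rw [← mul_assoc]
          refine le_mul_of_one_le_left (by positivity) ?_
          have hk : (h : ℝ) + 1 ≤ k := by exact_mod_cast Finset.mem_range.1 hh
          calc (1 : ℝ) = ((h : ℝ) + 1) ^ (1 + δ) * ((h : ℝ) + 1) ^ (-(1 + δ)) := by
                rw [← Real.rpow_add (by positivity)]; simp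
            _ ≤ _ := by gcongr
      _ = (k : ℝ) ^ (1 + δ) * ∑ h ∈ Finset.range k,
          (((h : ℝ) + 1) ^ (-(1 + δ)) * ‖1 - q h‖ ^ (-(1 - δ))) := by rw [Finset.mul_sum]
      _ ≤ _ := by
          gcongr
          exact hsum.sum_le_tsum _ fun h _ => hnn h
  -- The squared sum is at most k + 2 · k^δ · 2k^{1+δ}F. Since 1 + 4F ≥ 1, its square dominates it,
  -- so no square root of the constant is needed.
  refine ⟨1 + 4 * F, by positivity, fun a k x => ?_⟩
  rcases Nat.eq_zero_or_pos k with rfl | hk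
  · simp; positivity
  have hk1 : (1 : ℝ) ≤ k := by exact_mod_cast hk
  have hsq : ‖∑ n ∈ Finset.range k, gaussWeight t x (a + n)‖ ^ 2
      ≤ (1 + 4 * F) * (k : ℝ) ^ (1 + 2 * δ) := by
    rw [normSq_sum_range_eq]
    have h1 : ∑ n ∈ Finset.range k, ‖gaussWeight t x (a + n)‖ ^ 2 = k := by
      simp [norm_gaussWeight]
    have h2 : ∀ h ∈ Finset.range k, ‖∑ n ∈ Finset.range (k - 1 - h),
        gaussWeight t x (a + (n + h + 1 : ℕ)) * (starRingEnd ℂ) (gaussWeight t x (a + n))‖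
        ≤ (k : ℝ) ^ δ * (2 * ‖1 - q h‖ ^ (-(1 - δ))) := by
      intro h hh
      have e : ∀ n ∈ Finset.range (k - 1 - h),
          gaussWeight t x (a + (n + h + 1 : ℕ)) * (starRingEnd ℂ) (gaussWeight t x (a + n))
          = gaussWeight t x (h + 1) * Complex.exp (2 * Complex.I * (h + 1) * a * t) * q h ^ n := by
        intro n _
        have : (a + (n + h + 1 : ℕ) : ℤ) = (a + n) + (h + 1) := by push_cast; ring
        rw [this, gaussWeight_mul_conj, hq, mul_assoc (gaussWeight _ _ _),
          ← Complex.exp_nat_mul, ← Complex.exp_add]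
        congr 2
        push_cast
        ring
      have e3 : ‖Complex.exp (2 * Complex.I * (h + 1) * a * t)‖ = 1 := by
        have : (2 * Complex.I * (h + 1) * a * t : ℂ)
          = ((2 * (h + 1) * a * t : ℝ) : ℂ) * Complex.I := by push_cast; ring
        rw [this, Complex.norm_exp_ofReal_mul_I]
      have e4 : ‖q h‖ = 1 := by
        have : (2 * Complex.I * (h + 1) * t : ℂ)
          = ((2 * (h + 1) * t : ℝ) : ℂ) * Complex.I := by push_cast; ring
        rw [hq]
        simp only [this, Complex.norm_exp_ofReal_mul_I]
      rw [Finset.sum_congr rfl e, ← Finset.mul_sum, norm_mul, norm_mul, norm_gaussWeight, e3,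
        one_mul, one_mul]
      refine (norm_geom_sum_le e4 (hq1 h) hδ0.le hδ1.le _).trans ?_
      gcongr
      omega
    have h3 : (∑ h ∈ Finset.range k, ∑ n ∈ Finset.range (k - 1 - h),
        gaussWeight t x (a + (n + h + 1 : ℕ)) * (starRingEnd ℂ) (gaussWeight t x (a + n))).re
        ≤ (k : ℝ) ^ δ * (2 * ((k : ℝ) ^ (1 + δ) * F)) := by
      refine (Complex.re_le_norm _).trans ((norm_sum_le _ _).trans
        ((Finset.sum_le_sum h2).trans ?_))
      rw [← Finset.mul_sum, ← Finset.mul_sum]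
      gcongr
      exact hφ k
    have h4 : (k : ℝ) ^ δ * (2 * ((k : ℝ) ^ (1 + δ) * F)) = 2 * F * (k : ℝ) ^ (1 + 2 * δ) := by
      rw [show 1 + 2 * δ = δ + (1 + δ) by ring, Real.rpow_add (by positivity : (0 : ℝ) < k) δ]
      ring
    have h5 : (k : ℝ) ≤ (k : ℝ) ^ (1 + 2 * δ) := by
      calc (k : ℝ) = (k : ℝ) ^ (1 : ℝ) := by simp
        _ ≤ _ := Real.rpow_le_rpow_of_exponent_le hk1 (by linarith)
    rw [h1]
    linarith
  have hsq2 : (1 + 4 * F) * (k : ℝ) ^ (1 + 2 * δ)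
      ≤ ((1 + 4 * F) * (k : ℝ) ^ (1 / 2 + δ)) ^ 2 := by
    rw [mul_pow, ← Real.rpow_natCast ((k : ℝ) ^ (1 / 2 + δ)), ← Real.rpow_mul (by positivity)]
    have : (1 / 2 + δ) * (2 : ℕ) = 1 + 2 * δ := by push_cast; ring
    rw [this]
    gcongr
    nlinarith
  exact le_of_sq_le_sq (hsq.trans hsq2) (by positivity)

/-! ### Brackets and the variation in space of exponential sums -/

theorem one_le_bracket (m : Fin 2 → ℤ) : 1 ≤ bracket m := by
  unfold bracket latticeNormSq
  rw [Real.one_le_sqrt]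
  nlinarith [sq_nonneg (m 0 : ℝ), sq_nonneg (m 1 : ℝ)]

theorem bracket_pos (m : Fin 2 → ℤ) : 0 < bracket m := one_pos.trans_le (one_le_bracket m)

theorem abs_le_bracket (m : Fin 2 → ℤ) (i : Fin 2) : |(m i : ℝ)| ≤ bracket m := by
  unfold bracket latticeNormSq
  apply Real.abs_le_sqrt
  fin_cases i <;> simp <;> nlinarith [sq_nonneg (m 0 : ℝ), sq_nonneg (m 1 : ℝ)]

theorem norm_fourier_sub_one_le (n : ℤ) (x : UnitAddCircle) :
    ‖fourier n x - 1‖ ≤ 2 * Real.pi * |(n : ℝ)| * ‖x‖ := by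
  obtain ⟨r, rfl, hr⟩ : ∃ r : ℝ, (r : UnitAddCircle) = x ∧ ‖x‖ = |r| := by
    obtain ⟨r, rfl⟩ := QuotientAddGroup.mk_surjective x
    refine ⟨r - round r, ?_, ?_⟩
    · have : ((round r : ℝ) : UnitAddCircle) = 0 := by
        rw [AddCircle.coe_eq_zero_iff]
        exact ⟨round r, by simp⟩
      rw [AddCircle.coe_sub, this, sub_zero]
    · exact UnitAddCircle.norm_eq
  have : (2 * Real.pi * Complex.I * n * r / (1 : ℝ) : ℂ)
      = Complex.I * ((2 * Real.pi * n * r : ℝ) : ℂ) := by push_cast; ring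
  rw [fourier_coe_apply, this, hr]
  refine Real.norm_exp_I_mul_ofReal_sub_one_le.trans (le_of_eq ?_)
  rw [Real.norm_eq_abs, abs_mul, abs_mul, abs_of_pos Real.two_pi_pos]

/-- The variation in space of a quadratic exponential sum with frequencies in `[-2N, 2N]`. -/
theorem norm_sum_gaussWeight_sub_le {t W γ : ℝ} (hγ0 : 0 ≤ γ) (hγ1 : γ ≤ 1) {N : ℕ} (hN : 1 ≤ N)
    {a : ℤ} {k : ℕ} (ha : -(2 * N : ℤ) ≤ a) (hk : a + k ≤ 2 * N) (hk4 : k ≤ 4 * N)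
    (hW : ∀ (x : UnitAddCircle), ∀ j ≤ k, ‖∑ n ∈ Finset.range j, gaussWeight t x (a + n)‖ ≤ W)
    (x y : UnitAddCircle) :
    ‖∑ n ∈ Finset.range k, (gaussWeight t x (a + n) - gaussWeight t y (a + n))‖ ≤
      64 * (N * dist x y) ^ γ * W := by
  have hW0 : 0 ≤ W := (norm_nonneg _).trans (hW x 0 (Nat.zero_le _))
  have hN' : (1 : ℝ) ≤ N := by exact_mod_cast hN
  set X : ℝ := N * dist x y with hX
  have hX0 : 0 ≤ X := by positivity
  have htriv : ‖∑ n ∈ Finset.range k, (gaussWeight t x (a + n) - gaussWeight t y (a + n))‖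
      ≤ 2 * W := by
    rw [Finset.sum_sub_distrib]
    refine (norm_sub_le _ _).trans ?_
    linarith [hW x k le_rfl, hW y k le_rfl]
  have hdiff : ‖∑ n ∈ Finset.range k, (gaussWeight t x (a + n) - gaussWeight t y (a + n))‖
      ≤ 64 * X * W := by
    -- The change of x multiplies the weight by a factor that is small and varies slowly in n, so
    -- Abel summation applies again.
    have e : ∀ n : ℕ, gaussWeight t x (a + n) - gaussWeight t y (a + n)
        = (1 - fourier (a + n) (y - x)) * gaussWeight t x (a + n) := by
      intro n
      have h1 : fourier (a + n) y = fourier (a + n) (y - x) * fourier (a + n) x := by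
        conv_lhs => rw [show y = (y - x) + x by abel]
        simp only [fourier_apply, smul_add, AddCircle.toCircle_add, Circle.coe_mul]
      rw [gaussWeight, gaussWeight, h1]
      ring
    simp_rw [e]
    have hpi := Real.pi_le_four
    have hpi0 := Real.pi_pos
    have hd : ‖y - x‖ = dist x y := by rw [dist_comm, dist_eq_norm]
    have hd0 : 0 ≤ dist x y := dist_nonneg
    -- With 2π ≤ 8 the factor is at most 16X and its increments at most 8 `dist x y`. The larger
    -- value 32X is what the requirement k d ≤ a asks for when k ≤ 4N.
    refine (norm_sum_mul_le_of_partial_sums (a := 32 * X) (d := 8 * dist x y)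
      (by positivity) (hW x) ?_ ?_ ?_).trans (by linarith)
    · intro n hn
      rw [norm_sub_rev]
      refine (norm_fourier_sub_one_le _ _).trans ?_
      have h2 : |((a + n : ℤ) : ℝ)| ≤ 2 * N := by
        rw [abs_le]
        constructor
        · have : -(2 * N : ℤ) ≤ a + n := by omega
          exact_mod_cast this
        · have : a + n ≤ 2 * N := by omega
          exact_mod_cast this
      rw [hd, hX]
      calc 2 * Real.pi * |((a + n : ℤ) : ℝ)| * dist x y ≤ 2 * 4 * (2 * N) * dist x y := by gcongr
        _ ≤ _ := by nlinarith [mul_nonneg (by positivity : (0 : ℝ) ≤ N) hd0]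
    · intro n hn
      have h3 : (1 - fourier (a + (n + 1 : ℕ)) (y - x)) - (1 - fourier (a + n) (y - x))
          = - (fourier (a + n) (y - x) * (fourier 1 (y - x) - 1)) := by
        rw [show a + ((n + 1 : ℕ) : ℤ) = (a + n) + 1 by push_cast; ring, fourier_add]
        ring
      rw [h3, norm_neg, norm_mul, fourier_apply, Circle.norm_coe, one_mul]
      refine (norm_fourier_sub_one_le _ _).trans ?_
      rw [hd]
      simp only [Int.cast_one, abs_one, mul_one]
      gcongr
      linarith
    · have : (k : ℝ) ≤ 4 * N := by exact_mod_cast hk4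
      rw [hX]
      calc (k : ℝ) * (8 * dist x y) ≤ 4 * N * (8 * dist x y) := by gcongr
        _ = _ := by ring
  -- Both cases amount to min(X, 1) ≤ X^γ for 0 ≤ γ ≤ 1.
  rcases le_total X 1 with h | h
  · refine hdiff.trans ?_
    gcongr
    calc X = X ^ (1 : ℝ) := by simp
      _ ≤ X ^ γ := Real.rpow_le_rpow_of_exponent_ge' hX0 h hγ0 hγ1
  · refine htriv.trans ?_
    have : 1 ≤ X ^ γ := Real.one_le_rpow h hγ0
    nlinarith

/-! ### Lattice rectangles and dyadic squares -/

/-- The sum of `g` over the lattice rectangle `[a₁, a₁ + k₁) × [a₂, a₂ + k₂)`. -/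
def rectSum {E : Type*} [AddCommMonoid E] (g : (Fin 2 → ℤ) → E) (a₁ a₂ : ℤ) (k₁ k₂ : ℕ) : E :=
  ∑ q ∈ Finset.range k₂, ∑ p ∈ Finset.range k₁, g ![a₁ + p, a₂ + q]

theorem rectSum_add_left {E : Type*} [AddCommMonoid E] (g : (Fin 2 → ℤ) → E) (a₁ a₂ : ℤ)
    (k₁ l k₂ : ℕ) :
    rectSum g a₁ a₂ (k₁ + l) k₂ = rectSum g a₁ a₂ k₁ k₂ + rectSum g (a₁ + k₁) a₂ l k₂ := by
  simp only [rectSum, Finset.sum_range_add, Finset.sum_add_distrib, Nat.cast_add, add_assoc]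

theorem rectSum_add_right {E : Type*} [AddCommMonoid E] (g : (Fin 2 → ℤ) → E) (a₁ a₂ : ℤ)
    (k₁ k₂ l : ℕ) :
    rectSum g a₁ a₂ k₁ (k₂ + l) = rectSum g a₁ a₂ k₁ k₂ + rectSum g a₁ (a₂ + k₂) k₁ l := by
  simp only [rectSum, Finset.sum_range_add, Nat.cast_add, add_assoc]

/-- The lattice square `[-N, N)²`. -/
noncomputable def latticeBox (N : ℕ) : Finset (Fin 2 → ℤ) := Fintype.piFinset fun _ => Finset.Ico (-(N : ℤ)) N

theorem mem_latticeBox {N : ℕ} {m : Fin 2 → ℤ} :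
    m ∈ latticeBox N ↔ ∀ i, -(N : ℤ) ≤ m i ∧ m i < N := by
  simp [latticeBox]

theorem sum_latticeBox {E : Type*} [AddCommMonoid E] (g : (Fin 2 → ℤ) → E) (N : ℕ) :
    ∑ m ∈ latticeBox N, g m = rectSum g (-N) (-N) (2 * N) (2 * N) := by
  rw [rectSum, ← Finset.sum_product']
  symm
  refine Finset.sum_nbij' (fun z => ![-N + z.2, -N + z.1])
    (fun m => ((m 1 + N).toNat, (m 0 + N).toNat)) ?_ ?_ ?_ ?_ ?_
  · rintro ⟨q, p⟩ h
    simp only [Finset.mem_product, Finset.mem_range] at h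
    rw [mem_latticeBox, Fin.forall_fin_two]
    simp
    omega
  · intro m h
    rw [mem_latticeBox, Fin.forall_fin_two] at h
    simp only [Finset.mem_product, Finset.mem_range]
    omega
  · rintro ⟨q, p⟩ h
    simp
  · intro m h
    rw [mem_latticeBox, Fin.forall_fin_two] at h
    ext i
    fin_cases i
    · simp; omega
    · simp; omega
  · intro z _
    rfl

/-- The square annulus splits into two full-width horizontal strips and two side rectangles. On each
of the four, one coordinate has absolute value at least N. -/
theorem sum_latticeBox_two_mul {E : Type*} [AddCommGroup E] (g : (Fin 2 → ℤ) → E) (N : ℕ) :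
    ∑ m ∈ latticeBox (2 * N), g m - ∑ m ∈ latticeBox N, g m =
      rectSum g (-(2 * N)) (-(2 * N)) (4 * N) N + rectSum g (-(2 * N)) N (4 * N) N +
      (rectSum g (-(2 * N)) (-N) N (2 * N) + rectSum g N (-N) N (2 * N)) := by
  rw [sum_latticeBox, sum_latticeBox]
  have h1 := rectSum_add_right g (-(2 * N)) (-(2 * N)) (4 * N) N (2 * N + N)
  have h2 := rectSum_add_right g (-(2 * N)) (-N) (4 * N) (2 * N) N
  have h3 := rectSum_add_left g (-(2 * N)) (-N) N (2 * N + N) (2 * N)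
  have h4 := rectSum_add_left g (-N) (-N) (2 * N) N (2 * N)
  rw [show 2 * (2 * N) = 4 * N by ring]
  rw [show N + (2 * N + N) = 4 * N by ring] at h1 h3
  have e1 : -(2 * N : ℤ) + N = -N := by ring
  have e2 : -(N : ℤ) + (2 * N : ℕ) = N := by push_cast; ring
  rw [e1] at h1 h3
  rw [e2] at h2 h4
  push_cast
  rw [h1, h2, h3, h4]
  abel

/-! ### Estimates for dyadic blocks of the flow -/

/-- The smoothness conditions on Fourier coefficients under which exponential sums can be summed
by parts. -/
structure CoeffDecay (A : (Fin 2 → ℤ) → ℂ) (s C : ℝ) : Prop where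
  nonneg : 0 ≤ C
  le : ∀ m, ‖A m‖ ≤ C / bracket m ^ (1 + s)
  fst : ∀ m, ‖A ![m 0 + 1, m 1] - A m‖ ≤ C / bracket m ^ (2 + s)
  snd : ∀ m, ‖A ![m 0, m 1 + 1] - A m‖ ≤ C / bracket m ^ (2 + s)
  mixed : ∀ m, ‖A ![m 0 + 1, m 1 + 1] - A ![m 0 + 1, m 1] - A ![m 0, m 1 + 1] + A m‖ ≤
    C / bracket m ^ (3 + s)

/-- The bound for a product-weighted rectangular sum at distance at least `N` from the origin. -/
theorem CoeffDecay.norm_sum_sum_le {A : (Fin 2 → ℤ) → ℂ} {s C : ℝ} (hA : CoeffDecay A s C)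
    (hs : 0 < s) {N : ℕ} (hN : 1 ≤ N) {a₁ a₂ : ℤ} {k₁ k₂ : ℕ} (hk₁ : k₁ ≤ 4 * N)
    (hk₂ : k₂ ≤ 4 * N) (hb : ∀ p < k₁, ∀ q < k₂, (N : ℝ) ≤ bracket ![a₁ + (p : ℤ), a₂ + (q : ℤ)])
    {w₁ w₂ : ℕ → ℂ} {W₁ W₂ : ℝ} (hW₁ : ∀ j ≤ k₁, ‖∑ n ∈ Finset.range j, w₁ n‖ ≤ W₁)
    (hW₂ : ∀ j ≤ k₂, ‖∑ n ∈ Finset.range j, w₂ n‖ ≤ W₂) :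
    ‖∑ q ∈ Finset.range k₂, (∑ p ∈ Finset.range k₁, A ![a₁ + p, a₂ + q] * w₁ p) * w₂ q‖ ≤
      64 * C * (N : ℝ) ^ (-(1 + s)) * W₁ * W₂ := by
  have hN' : (1 : ℝ) ≤ N := by exact_mod_cast hN
  have hN0 : (0 : ℝ) < N := by linarith
  have hC := hA.nonneg
  have hdec : ∀ (e : ℝ), 0 ≤ e → ∀ p < k₁, ∀ q < k₂,
      C / bracket ![a₁ + (p : ℤ), a₂ + (q : ℤ)] ^ e ≤ C * (N : ℝ) ^ (-e) := by
    intro e he p hp q hq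
    rw [div_eq_mul_inv, Real.rpow_neg hN0.le]
    gcongr
    exact hb p hp q hq
  have h1 : (N : ℝ) ^ (-(2 + s)) = N ^ (-(1 + s)) / N := by
    rw [show -(2 + s) = -(1 + s) - 1 by ring, Real.rpow_sub_one hN0.ne']
  have h2 : (N : ℝ) ^ (-(3 + s)) = N ^ (-(1 + s)) / N ^ 2 := by
    rw [show -(3 + s) = -(1 + s) - (2 : ℕ) by push_cast; ring, Real.rpow_sub_natCast hN0.ne']
  have hP : 0 ≤ (N : ℝ) ^ (-(1 + s)) := by positivity
  -- L = 4N bounds the sides of the rectangles. The factor 16 makes a / L² exactly C N^{-(3+s)}, the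
  -- bound for the mixed difference; the other three bounds then have room to spare.
  have key := norm_sum_sum_mul_le_of_partial_sums (A := fun p q => A ![a₁ + p, a₂ + q])
    (a := 16 * C * (N : ℝ) ^ (-(1 + s))) (L := 4 * N) (by positivity)
    (by exact_mod_cast hk₁) (by exact_mod_cast hk₂) (by positivity) hW₁ hW₂ ?_ ?_ ?_ ?_
  · refine key.trans (le_of_eq ?_)
    ring
  · intro p hp q hq
    refine ((hA.le _).trans (hdec _ (by linarith) p hp q hq)).trans ?_
    nlinarith [mul_nonneg hC hP]
  · intro p hp q hq
    have := (hA.fst _).trans (hdec _ (by linarith) p hp q hq)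
    rw [h1] at this
    have e : (16 * C * (N : ℝ) ^ (-(1 + s)) / (4 * N)) = 4 * (C * (N ^ (-(1 + s)) / N)) := by
      field_simp; ring
    rw [e]
    simp only [Matrix.cons_val_zero, Matrix.cons_val_one, add_assoc] at this
    push_cast
    refine this.trans ?_
    have : 0 ≤ C * ((N : ℝ) ^ (-(1 + s)) / N) := by positivity
    linarith
  · intro p hp q hq
    have := (hA.snd _).trans (hdec _ (by linarith) p hp q hq)
    rw [h1] at this
    have e : (16 * C * (N : ℝ) ^ (-(1 + s)) / (4 * N)) = 4 * (C * (N ^ (-(1 + s)) / N)) := by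
      field_simp; ring
    rw [e]
    simp only [Matrix.cons_val_zero, Matrix.cons_val_one, add_assoc] at this
    push_cast
    refine this.trans ?_
    have : 0 ≤ C * ((N : ℝ) ^ (-(1 + s)) / N) := by positivity
    linarith
  · intro p hp q hq
    have := (hA.mixed _).trans (hdec _ (by linarith) p hp q hq)
    rw [h2] at this
    have e : (16 * C * (N : ℝ) ^ (-(1 + s)) / (4 * N) ^ 2) = C * (N ^ (-(1 + s)) / N ^ 2) := by
      field_simp; ring
    rw [e]
    simp only [Matrix.cons_val_zero, Matrix.cons_val_one, add_assoc] at this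
    push_cast
    simpa only [add_assoc] using this

/-- A single Fourier mode of the Schrödinger flow. -/
noncomputable def flowTerm (A : (Fin 2 → ℤ) → ℂ) (t : ℝ) (m : Fin 2 → ℤ) : C(Torus2, ℂ) :=
  (Complex.exp (Complex.I * ((latticeNormSq m * t : ℝ) : ℂ)) * A m) • UnitAddTorus.mFourier m

theorem flowTerm_apply (A : (Fin 2 → ℤ) → ℂ) (t : ℝ) (m : Fin 2 → ℤ) (x : Torus2) :
    flowTerm A t m x = A m * gaussWeight t (x 0) (m 0) * gaussWeight t (x 1) (m 1) := by
  have : Complex.exp (Complex.I * ((latticeNormSq m * t : ℝ) : ℂ)) =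
      Complex.exp (Complex.I * (((m 0 : ℝ) ^ 2 * t : ℝ) : ℂ)) *
      Complex.exp (Complex.I * (((m 1 : ℝ) ^ 2 * t : ℝ) : ℂ)) := by
    rw [← Complex.exp_add]
    congr 1
    simp only [latticeNormSq]
    push_cast
    ring
  simp only [flowTerm, ContinuousMap.smul_apply, smul_eq_mul, gaussWeight, this,
    UnitAddTorus.mFourier, ContinuousMap.coe_mk, Fin.prod_univ_two]
  ring

/-- The conclusion of Weyl's estimate at a time `t`, with constant `G` and loss `δ`. -/
def WeylBound (t δ G : ℝ) : Prop :=
  ∀ (a : ℤ) (k : ℕ) (x : UnitAddCircle),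
    ‖∑ n ∈ Finset.range k, gaussWeight t x (a + n)‖ ≤ G * (k : ℝ) ^ (1 / 2 + δ)

theorem WeylBound.le_of_le {t δ G : ℝ} (h : WeylBound t δ G) (hG : 0 ≤ G) (hδ : 0 < δ) {k M : ℕ}
    (hk : k ≤ M) (a : ℤ) (x : UnitAddCircle) :
    ∀ j ≤ k, ‖∑ n ∈ Finset.range j, gaussWeight t x (a + n)‖ ≤ G * (M : ℝ) ^ (1 / 2 + δ) := by
  intro j hj
  refine (h a j x).trans ?_
  gcongr
  exact hj.trans hk

/-- The power of `N` that results from the decay of the coefficients and from Weyl's estimate. -/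
theorem rpow_mul_sq_le {N : ℕ} (hN : 1 ≤ N) {s δ : ℝ} (hδ : δ ≤ 1) :
    (N : ℝ) ^ (-(1 + s)) * ((4 * N : ℕ) : ℝ) ^ (1 / 2 + δ) * ((4 * N : ℕ) : ℝ) ^ (1 / 2 + δ) ≤
      64 * (N : ℝ) ^ (2 * δ - s) := by
  have hN0 : (0 : ℝ) < N := by exact_mod_cast hN
  push_cast
  rw [mul_assoc, ← Real.rpow_add (by positivity), Real.mul_rpow (by norm_num) hN0.le,
    mul_left_comm, ← Real.rpow_add hN0]
  rw [show -(1 + s) + (1 / 2 + δ + (1 / 2 + δ)) = 2 * δ - s by ring]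
  gcongr
  calc (4 : ℝ) ^ (1 / 2 + δ + (1 / 2 + δ)) ≤ 4 ^ (3 : ℝ) :=
        Real.rpow_le_rpow_of_exponent_le (by norm_num) (by linarith)
    _ = 64 := by norm_num

section Blocks

variable {A : (Fin 2 → ℤ) → ℂ} {s C t δ G : ℝ} {N : ℕ} {a₁ a₂ : ℤ} {k₁ k₂ : ℕ}

theorem rectSum_flowTerm_apply (x : Torus2) :
    rectSum (flowTerm A t) a₁ a₂ k₁ k₂ x = ∑ q ∈ Finset.range k₂, (∑ p ∈ Finset.range k₁,
      A ![a₁ + p, a₂ + q] * gaussWeight t (x 0) (a₁ + p)) * gaussWeight t (x 1) (a₂ + q) := by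
  simp only [rectSum, ContinuousMap.coe_sum, Finset.sum_apply, flowTerm_apply,
    Matrix.cons_val_zero, Matrix.cons_val_one, Finset.sum_mul]

theorem CoeffDecay.norm_rectSum_le (hA : CoeffDecay A s C) (hs : 0 < s) (hG : 0 ≤ G)
    (hw : WeylBound t δ G) (hδ0 : 0 < δ) (hδ1 : δ ≤ 1) (hN : 1 ≤ N) (hk₁ : k₁ ≤ 4 * N)
    (hk₂ : k₂ ≤ 4 * N) (hb : ∀ p < k₁, ∀ q < k₂, (N : ℝ) ≤ bracket ![a₁ + (p : ℤ), a₂ + (q : ℤ)])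
    (x : Torus2) :
    ‖rectSum (flowTerm A t) a₁ a₂ k₁ k₂ x‖ ≤ 2 ^ 20 * (C * G ^ 2) * (N : ℝ) ^ (2 * δ - s) := by
  have hC := hA.nonneg
  rw [rectSum_flowTerm_apply]
  refine (hA.norm_sum_sum_le hs hN hk₁ hk₂ hb (hw.le_of_le hG hδ0 hk₁ a₁ (x 0))
    (hw.le_of_le hG hδ0 hk₂ a₂ (x 1))).trans ?_
  have := rpow_mul_sq_le (s := s) hN hδ1
  set P := (N : ℝ) ^ (-(1 + s))
  set Q := ((4 * N : ℕ) : ℝ) ^ (1 / 2 + δ)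
  have hR : 0 ≤ (N : ℝ) ^ (2 * δ - s) := by positivity
  set R := (N : ℝ) ^ (2 * δ - s)
  calc 64 * C * P * (G * Q) * (G * Q) = 64 * (C * G ^ 2) * (P * Q * Q) := by ring
    _ ≤ 64 * (C * G ^ 2) * (64 * R) := by gcongr
    _ = 2 ^ 12 * ((C * G ^ 2) * R) := by ring
    _ ≤ 2 ^ 20 * ((C * G ^ 2) * R) := by gcongr <;> norm_num
    _ = _ := by ring

/-- The product of weights is varied one coordinate at a time. The varied weight gains (N `dist x
y`)^γ in its partial sums; the other keeps Weyl's bound. -/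
theorem CoeffDecay.norm_rectSum_sub_le (hA : CoeffDecay A s C) (hs : 0 < s) (hG : 0 ≤ G)
    (hw : WeylBound t δ G) (hδ0 : 0 < δ) (hδ1 : δ ≤ 1) (hN : 1 ≤ N) (hk₁ : k₁ ≤ 4 * N)
    (hk₂ : k₂ ≤ 4 * N) (ha₁ : -(2 * N : ℤ) ≤ a₁) (ha₁' : a₁ + k₁ ≤ 2 * N)
    (ha₂ : -(2 * N : ℤ) ≤ a₂) (ha₂' : a₂ + k₂ ≤ 2 * N)
    (hb : ∀ p < k₁, ∀ q < k₂, (N : ℝ) ≤ bracket ![a₁ + (p : ℤ), a₂ + (q : ℤ)])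
    {γ : ℝ} (hγ0 : 0 ≤ γ) (hγ1 : γ ≤ 1) (x y : Torus2) :
    ‖rectSum (flowTerm A t) a₁ a₂ k₁ k₂ x - rectSum (flowTerm A t) a₁ a₂ k₁ k₂ y‖ ≤
      2 ^ 20 * (C * G ^ 2) * (N : ℝ) ^ (γ + 2 * δ - s) * dist x y ^ γ := by
  have hC := hA.nonneg
  have hN0 : (0 : ℝ) < N := by exact_mod_cast hN
  have hdist : ∀ i, dist (x i) (y i) ≤ dist x y := fun i => dist_le_pi_dist x y i
  have e : rectSum (flowTerm A t) a₁ a₂ k₁ k₂ x - rectSum (flowTerm A t) a₁ a₂ k₁ k₂ y =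
      (∑ q ∈ Finset.range k₂, (∑ p ∈ Finset.range k₁, A ![a₁ + p, a₂ + q] *
        (gaussWeight t (x 0) (a₁ + p) - gaussWeight t (y 0) (a₁ + p))) *
          gaussWeight t (x 1) (a₂ + q)) +
      ∑ q ∈ Finset.range k₂, (∑ p ∈ Finset.range k₁, A ![a₁ + p, a₂ + q] *
        gaussWeight t (y 0) (a₁ + p)) *
          (gaussWeight t (x 1) (a₂ + q) - gaussWeight t (y 1) (a₂ + q)) := by
    rw [rectSum_flowTerm_apply, rectSum_flowTerm_apply, ← Finset.sum_sub_distrib,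
      ← Finset.sum_add_distrib]
    refine Finset.sum_congr rfl fun q _ => ?_
    simp only [mul_sub, Finset.sum_sub_distrib]
    ring
  have hvar : ∀ (a : ℤ) (k : ℕ) (i : Fin 2), -(2 * N : ℤ) ≤ a → a + k ≤ 2 * N → k ≤ 4 * N →
      ∀ j ≤ k, ‖∑ n ∈ Finset.range j,
        (gaussWeight t (x i) (a + n) - gaussWeight t (y i) (a + n))‖ ≤
        64 * (N * dist x y) ^ γ * (G * ((4 * N : ℕ) : ℝ) ^ (1 / 2 + δ)) := by
    intro a k i ha ha' hk j hj
    refine (norm_sum_gaussWeight_sub_le hγ0 hγ1 hN ha (by omega) (hj.trans hk)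
      (fun z => hw.le_of_le hG hδ0 (hj.trans hk) a z) (x i) (y i)).trans ?_
    gcongr
    exact hdist i
  have h1 := hA.norm_sum_sum_le hs hN hk₁ hk₂ hb (hvar a₁ k₁ 0 ha₁ ha₁' hk₁)
    (hw.le_of_le hG hδ0 hk₂ a₂ (x 1))
  have h2 := hA.norm_sum_sum_le hs hN hk₁ hk₂ hb (hw.le_of_le hG hδ0 hk₁ a₁ (y 0))
    (hvar a₂ k₂ 1 ha₂ ha₂' hk₂)
  rw [e]
  refine (norm_add_le _ _).trans ((add_le_add h1 h2).trans ?_)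
  have := rpow_mul_sq_le (s := s) hN hδ1
  have hsplit : (N : ℝ) ^ (γ + 2 * δ - s) = (N : ℝ) ^ γ * (N : ℝ) ^ (2 * δ - s) := by
    rw [← Real.rpow_add hN0]; ring_nf
  rw [hsplit, Real.mul_rpow hN0.le dist_nonneg]
  set P := (N : ℝ) ^ (-(1 + s))
  set Q := ((4 * N : ℕ) : ℝ) ^ (1 / 2 + δ)
  have hR : 0 ≤ (N : ℝ) ^ (2 * δ - s) := by positivity
  set R := (N : ℝ) ^ (2 * δ - s)
  have hD : 0 ≤ (N : ℝ) ^ γ * dist x y ^ γ := by positivity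
  calc _ = 2 ^ 13 * (C * G ^ 2) * ((N : ℝ) ^ γ * dist x y ^ γ) * (P * Q * Q) := by ring
    _ ≤ 2 ^ 13 * (C * G ^ 2) * ((N : ℝ) ^ γ * dist x y ^ γ) * (64 * R) := by gcongr
    _ = 2 ^ 19 * ((C * G ^ 2) * ((N : ℝ) ^ γ * dist x y ^ γ) * R) := by ring
    _ ≤ 2 ^ 20 * ((C * G ^ 2) * ((N : ℝ) ^ γ * dist x y ^ γ) * R) := by gcongr <;> norm_num
    _ = _ := by ring

theorem le_bracket_of_le_abs {m : Fin 2 → ℤ} (i : Fin 2) (h : (N : ℤ) ≤ |m i|) :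
    (N : ℝ) ≤ bracket m :=
  le_trans (by exact_mod_cast h) (abs_le_bracket m i)

/-- The partial sum of the flow over the square `[-N, N)²`. -/
noncomputable def flowSum (A : (Fin 2 → ℤ) → ℂ) (t : ℝ) (N : ℕ) : C(Torus2, ℂ) :=
  ∑ m ∈ latticeBox N, flowTerm A t m

theorem CoeffDecay.norm_flowSum_two_mul_sub_le (hA : CoeffDecay A s C) (hs : 0 < s) (hG : 0 ≤ G)
    (hw : WeylBound t δ G) (hδ0 : 0 < δ) (hδ1 : δ ≤ 1) (hN : 1 ≤ N) :
    ‖flowSum A t (2 * N) - flowSum A t N‖ ≤ 2 ^ 22 * (C * G ^ 2) * (N : ℝ) ^ (2 * δ - s) := by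
  have hC := hA.nonneg
  rw [ContinuousMap.norm_le _ (by positivity)]
  intro x
  rw [flowSum, flowSum, sum_latticeBox_two_mul]
  simp only [ContinuousMap.add_apply]
  have key : ∀ (a₁ a₂ : ℤ) (k₁ k₂ : ℕ), _ := fun a₁ a₂ k₁ k₂ =>
    hA.norm_rectSum_le (a₁ := a₁) (a₂ := a₂) (k₁ := k₁) (k₂ := k₂) hs hG hw hδ0 hδ1 hN
  have r1 := key (-(2 * N)) (-(2 * N)) (4 * N) N (by omega) (by omega)
    (fun p hp q hq => le_bracket_of_le_abs 1 (by simp; rw [le_abs]; omega)) x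
  have r2 := key (-(2 * N)) N (4 * N) N (by omega) (by omega)
    (fun p hp q hq => le_bracket_of_le_abs 1 (by simp; rw [le_abs]; omega)) x
  have r3 := key (-(2 * N)) (-N) N (2 * N) (by omega) (by omega)
    (fun p hp q hq => le_bracket_of_le_abs 0 (by simp; rw [le_abs]; omega)) x
  have r4 := key N (-N) N (2 * N) (by omega) (by omega)
    (fun p hp q hq => le_bracket_of_le_abs 0 (by simp; rw [le_abs]; omega)) x
  refine (norm_add_le _ _).trans ((add_le_add (norm_add_le _ _) (norm_add_le _ _)).trans ?_)
  refine (add_le_add (add_le_add r1 r2) (add_le_add r3 r4)).trans (le_of_eq ?_)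
  ring

/-- This starts the dyadic telescoping: [-1, 1)² is a rectangle at scale N = 1, where ⟨m⟩ ≥ N always
holds. -/
theorem CoeffDecay.norm_flowSum_one_sub_le (hA : CoeffDecay A s C) (hs : 0 < s) (hG : 0 ≤ G)
    (hw : WeylBound t δ G) (hδ0 : 0 < δ) (hδ1 : δ ≤ 1) {γ : ℝ} (hγ0 : 0 ≤ γ) (hγ1 : γ ≤ 1)
    (x y : Torus2) :
    ‖flowSum A t 1 x - flowSum A t 1 y‖ ≤ 2 ^ 20 * (C * G ^ 2) * dist x y ^ γ := by
  rw [flowSum, sum_latticeBox]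
  have := hA.norm_rectSum_sub_le (N := 1) (a₁ := -1) (a₂ := -1) (k₁ := 2) (k₂ := 2) hs hG hw hδ0
    hδ1 le_rfl (by norm_num) (by norm_num) (by norm_num) (by norm_num) (by norm_num) (by norm_num)
    (fun p hp q hq => by simpa using one_le_bracket _) hγ0 hγ1 x y
  simpa using this

theorem CoeffDecay.norm_flowSum_two_mul_sub_sub_le (hA : CoeffDecay A s C) (hs : 0 < s)
    (hG : 0 ≤ G) (hw : WeylBound t δ G) (hδ0 : 0 < δ) (hδ1 : δ ≤ 1) (hN : 1 ≤ N) {γ : ℝ}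
    (hγ0 : 0 ≤ γ) (hγ1 : γ ≤ 1) (x y : Torus2) :
    ‖(flowSum A t (2 * N) - flowSum A t N) x - (flowSum A t (2 * N) - flowSum A t N) y‖ ≤
      2 ^ 22 * (C * G ^ 2) * (N : ℝ) ^ (γ + 2 * δ - s) * dist x y ^ γ := by
  rw [flowSum, flowSum, sum_latticeBox_two_mul]
  simp only [ContinuousMap.add_apply, add_sub_add_comm]
  have key : ∀ (a₁ a₂ : ℤ) (k₁ k₂ : ℕ), _ := fun a₁ a₂ k₁ k₂ =>
    hA.norm_rectSum_sub_le (a₁ := a₁) (a₂ := a₂) (k₁ := k₁) (k₂ := k₂) hs hG hw hδ0 hδ1 hN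
  have r1 := key (-(2 * N)) (-(2 * N)) (4 * N) N (by omega) (by omega) (by omega) (by omega)
    (by omega) (by omega)
    (fun p hp q hq => le_bracket_of_le_abs 1 (by simp; rw [le_abs]; omega)) hγ0 hγ1 x y
  have r2 := key (-(2 * N)) N (4 * N) N (by omega) (by omega) (by omega) (by omega)
    (by omega) (by omega)
    (fun p hp q hq => le_bracket_of_le_abs 1 (by simp; rw [le_abs]; omega)) hγ0 hγ1 x y
  have r3 := key (-(2 * N)) (-N) N (2 * N) (by omega) (by omega) (by omega) (by omega)
    (by omega) (by omega)
    (fun p hp q hq => le_bracket_of_le_abs 0 (by simp; rw [le_abs]; omega)) hγ0 hγ1 x y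
  have r4 := key N (-N) N (2 * N) (by omega) (by omega) (by omega) (by omega)
    (by omega) (by omega)
    (fun p hp q hq => le_bracket_of_le_abs 0 (by simp; rw [le_abs]; omega)) hγ0 hγ1 x y
  refine (norm_add_le _ _).trans ((add_le_add (norm_add_le _ _) (norm_add_le _ _)).trans ?_)
  refine (add_le_add (add_le_add r1 r2) (add_le_add r3 r4)).trans (le_of_eq ?_)
  ring

end Blocks

/-! ### Uniform convergence and Hölder regularity -/

theorem two_pow_cast_rpow (j : ℕ) (e : ℝ) : ((2 ^ j : ℕ) : ℝ) ^ e = ((2 : ℝ) ^ e) ^ j := by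
  push_cast
  rw [← Real.rpow_natCast, ← Real.rpow_natCast, ← Real.rpow_mul (by norm_num),
    ← Real.rpow_mul (by norm_num), mul_comm]

theorem holderWith_of_dist_le {X Y : Type*} [PseudoMetricSpace X] [PseudoMetricSpace Y] {g : X → Y}
    {K γ : ℝ≥0} (h : ∀ x y, dist (g x) (g y) ≤ K * dist x y ^ (γ : ℝ)) : HolderWith K γ g := by
  intro x y
  rw [edist_dist, edist_dist, ENNReal.ofReal_rpow_of_nonneg dist_nonneg γ.coe_nonneg,
    ← ENNReal.ofReal_coe_nnreal, ← ENNReal.ofReal_mul K.coe_nonneg]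
  exact ENNReal.ofReal_le_ofReal (h x y)

/-- Weyl's estimate at a time `t` and smooth decay of the coefficients make the dyadic partial
sums converge uniformly, to a function that is Hölder of every order below `s`. -/
theorem CoeffDecay.exists_tendsto_flowSum {A : (Fin 2 → ℤ) → ℂ} {s C t : ℝ}
    (hA : CoeffDecay A s C) (hs : 0 < s) (hs1 : s < 1)
    (hw : ∀ δ, 0 < δ → δ < 1 → ∃ G, 0 ≤ G ∧ WeylBound t δ G) :
    ∃ v : C(Torus2, ℂ), Tendsto (fun j : ℕ => flowSum A t (2 ^ j)) atTop (𝓝 v) ∧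
      ∀ γ : ℝ≥0, (γ : ℝ) < s → ∃ K : ℝ≥0, HolderWith K γ v := by
  have hC := hA.nonneg
  have hN : ∀ j : ℕ, 1 ≤ 2 ^ j := fun j => Nat.one_le_two_pow
  have hlim : ∃ v : C(Torus2, ℂ), Tendsto (fun j : ℕ => flowSum A t (2 ^ j)) atTop (𝓝 v) := by
    -- With δ = s/4 the dyadic increments decay like 2^{-js/2}.
    obtain ⟨G, hG, hwG⟩ := hw (s / 4) (by linarith) (by linarith)
    refine cauchySeq_tendsto_of_complete (cauchySeq_of_le_geometric ((2 : ℝ) ^ (2 * (s / 4) - s))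
      (2 ^ 22 * (C * G ^ 2)) (Real.rpow_lt_one_of_one_lt_of_neg (by norm_num) (by linarith)) ?_)
    intro j
    rw [dist_comm, dist_eq_norm, ← two_pow_cast_rpow, pow_succ']
    exact hA.norm_flowSum_two_mul_sub_le hs hG hwG (by linarith) (by linarith) (hN j)
  obtain ⟨v, hv⟩ := hlim
  refine ⟨v, hv, fun γ hγ => ?_⟩
  have hγ0 : (0 : ℝ) ≤ γ := γ.2
  -- This δ makes the Hölder constants of the blocks decay with ratio 2^{-(s-γ)/2}. The resulting
  -- bound is uniform in j and survives the pointwise limit.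
  obtain ⟨G, hG, hwG⟩ := hw ((s - γ) / 4) (by linarith) (by linarith)
  set r : ℝ := (2 : ℝ) ^ (γ + 2 * ((s - γ) / 4) - s) with hr
  have hr0 : 0 ≤ r := by positivity
  have hr1 : r < 1 := Real.rpow_lt_one_of_one_lt_of_neg (by norm_num) (by linarith)
  set B := 2 ^ 22 * (C * G ^ 2) with hB
  have hB0 : 0 ≤ B := by positivity
  have hj : ∀ (j : ℕ) (x y : Torus2), ‖flowSum A t (2 ^ j) x - flowSum A t (2 ^ j) y‖ ≤
      (B + B * ∑ i ∈ Finset.range j, r ^ i) * dist x y ^ (γ : ℝ) := by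
    intro j x y
    induction j with
    | zero =>
      have := hA.norm_flowSum_one_sub_le hs hG hwG (by linarith) (by linarith) hγ0
        (by linarith) x y
      simp only [pow_zero, Finset.range_zero, Finset.sum_empty, mul_zero, add_zero]
      refine this.trans ?_
      rw [hB]
      gcongr <;> norm_num
    | succ j ih =>
      have := hA.norm_flowSum_two_mul_sub_sub_le hs hG hwG (by linarith) (by linarith) (hN j) hγ0
        (by linarith) x y
      rw [two_pow_cast_rpow, ← hr, ← hB] at this
      rw [Finset.sum_range_succ, pow_succ']
      have e : flowSum A t (2 * 2 ^ j) x - flowSum A t (2 * 2 ^ j) y =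
          (flowSum A t (2 ^ j) x - flowSum A t (2 ^ j) y) +
          ((flowSum A t (2 * 2 ^ j) - flowSum A t (2 ^ j)) x -
            (flowSum A t (2 * 2 ^ j) - flowSum A t (2 ^ j)) y) := by
        simp only [ContinuousMap.sub_apply]
        ring
      rw [e]
      refine (norm_add_le _ _).trans ((add_le_add ih this).trans (le_of_eq ?_))
      ring
  have hgeom : ∀ j : ℕ, ∑ i ∈ Finset.range j, r ^ i ≤ (1 - r)⁻¹ := fun j =>
    (tsum_geometric_of_lt_one hr0 hr1) ▸
      (summable_geometric_of_lt_one hr0 hr1).sum_le_tsum _ fun i _ => by positivity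
  have hr' : 0 < 1 - r := by linarith
  refine ⟨⟨B + B * (1 - r)⁻¹, by positivity⟩, holderWith_of_dist_le fun x y => ?_⟩
  have hx : ∀ x, Tendsto (fun j : ℕ => flowSum A t (2 ^ j) x) atTop (𝓝 (v x)) := fun x =>
    ((continuous_eval_const x).tendsto v).comp hv
  rw [dist_eq_norm]
  refine le_of_tendsto ((hx x).sub (hx y)).norm (Eventually.of_forall fun j => ?_)
  refine (hj j x y).trans ?_
  change _ ≤ (B + B * (1 - r)⁻¹) * dist x y ^ (γ : ℝ)
  gcongr
  exact hgeom j

/-! ### The flow in L² and its continuous representative -/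

theorem mFourierCoeff_congr_ae {f g : Torus2 → ℂ} (h : f =ᵐ[torusMeasure] g) (m : Fin 2 → ℤ) :
    UnitAddTorus.mFourierCoeff f m = UnitAddTorus.mFourierCoeff g m :=
  integral_congr_ae (h.mono fun x hx => by simp only [hx])

/-- Parseval's identity for the norm of a square-integrable function. -/
theorem hasSum_sq_norm_mFourierCoeff {f : Torus2 → ℂ} (hf : MemLp f 2 torusMeasure) :
    HasSum (fun m => ‖UnitAddTorus.mFourierCoeff f m‖ ^ 2) (∫ x, ‖f x‖ ^ 2 ∂torusMeasure) := by
  have h : HasSum (fun m => ‖UnitAddTorus.mFourierCoeff (hf.toLp f) m‖ ^ 2)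
      (∫ x, ‖hf.toLp f x‖ ^ 2 ∂torusMeasure) := UnitAddTorus.hasSum_sq_mFourierCoeff (hf.toLp f)
  have e : ∫ x, ‖f x‖ ^ 2 ∂torusMeasure = ∫ x, ‖hf.toLp f x‖ ^ 2 ∂torusMeasure :=
    integral_congr_ae (hf.coeFn_toLp.mono fun x hx => by simp only [hx])
  rw [e]
  simpa only [mFourierCoeff_congr_ae hf.coeFn_toLp] using h

/-- The series that defines the flow converges, and the flow preserves the moduli of the Fourier
coefficients. -/
theorem hasSum_schrodingerFlow {f : Torus2 → ℂ} (hf : MemLp f 2 torusMeasure) (t : ℝ) :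
    HasSum (fun m => ContinuousMap.toLp 2 torusMeasure ℂ
      (flowTerm (UnitAddTorus.mFourierCoeff f) t m)) (schrodingerFlow f t) ∧
    ∀ m, ‖UnitAddTorus.mFourierCoeff (schrodingerFlow f t) m‖ =
      ‖UnitAddTorus.mFourierCoeff f m‖ := by
  set c : (Fin 2 → ℤ) → ℂ := fun m =>
    Complex.exp (Complex.I * ((latticeNormSq m * t : ℝ) : ℂ)) * UnitAddTorus.mFourierCoeff f m
  have hc : ∀ m, ‖c m‖ = ‖UnitAddTorus.mFourierCoeff f m‖ := by
    intro m
    rw [norm_mul, mul_comm Complex.I, Complex.norm_exp_ofReal_mul_I, one_mul]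
  have hmem : Memℓp c 2 := by
    rw [memℓp_gen_iff (by norm_num)]
    simpa [hc] using (hasSum_sq_norm_mFourierCoeff hf).summable
  have h := UnitAddTorus.mFourierBasis.hasSum_repr_symm ⟨c, hmem⟩
  have h' : HasSum (fun m => ContinuousMap.toLp 2 torusMeasure ℂ
      (flowTerm (UnitAddTorus.mFourierCoeff f) t m))
      (UnitAddTorus.mFourierBasis.repr.symm ⟨c, hmem⟩) := by
    refine h.congr_fun fun m => ?_
    rw [UnitAddTorus.coe_mFourierBasis, flowTerm, map_smul]
    rfl
  have e : schrodingerFlow f t = ∑' m, ContinuousMap.toLp 2 torusMeasure ℂ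
      (flowTerm (UnitAddTorus.mFourierCoeff f) t m) := by
    simp only [schrodingerFlow, flowTerm, map_smul]
  rw [e, h'.tsum_eq]
  refine ⟨h', fun m => ?_⟩
  rw [← hc, ← UnitAddTorus.mFourierBasis_repr, LinearIsometryEquiv.apply_symm_apply]

theorem tendsto_latticeBox : Tendsto (fun j : ℕ => latticeBox (2 ^ j)) atTop atTop := by
  refine tendsto_atTop_finset_of_monotone (fun i j hij m hm => ?_) fun m => ?_
  · rw [mem_latticeBox] at hm ⊢
    have : ((2 ^ i : ℕ) : ℤ) ≤ (2 ^ j : ℕ) := by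
      exact_mod_cast Nat.pow_le_pow_right (by norm_num) hij
    intro k
    have := hm k
    omega
  · obtain ⟨j, hj⟩ := pow_unbounded_of_one_lt ((m 0).natAbs + (m 1).natAbs) one_lt_two
    refine ⟨j, ?_⟩
    rw [mem_latticeBox, Fin.forall_fin_two]
    omega

/-- Uniform convergence implies L² convergence, and the dyadic squares are cofinal among finite sets
of frequencies, so both limits agree. -/
theorem ae_eq_schrodingerFlow_of_tendsto {f : Torus2 → ℂ} (hf : MemLp f 2 torusMeasure) {t : ℝ}
    {v : C(Torus2, ℂ)} (hv : Tendsto (fun j : ℕ => flowSum (UnitAddTorus.mFourierCoeff f) t (2 ^ j))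
      atTop (𝓝 v)) : v =ᵐ[torusMeasure] schrodingerFlow f t := by
  have h1 := ((ContinuousMap.toLp (E := ℂ) 2 torusMeasure ℂ).continuous.tendsto v).comp hv
  have h2 := (hasSum_schrodingerFlow hf t).1.comp tendsto_latticeBox
  have h3 : ContinuousMap.toLp (E := ℂ) 2 torusMeasure ℂ v = schrodingerFlow f t := by
    refine tendsto_nhds_unique h1 (h2.congr fun j => ?_)
    simp only [Function.comp_apply, flowSum, map_sum]
  rw [← h3]
  exact (ContinuousMap.coeFn_toLp torusMeasure v).symm

/-- The bound weakens as δ grows, so the countably many values δ = 1/(n + 2) suffice and their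
exceptional sets have null union. -/
theorem ae_forall_weylBound :
    ∀ᵐ t : ℝ, ∀ δ, 0 < δ → δ < 1 → ∃ G, 0 ≤ G ∧ WeylBound t δ G := by
  have h : ∀ n : ℕ, ∀ᵐ t : ℝ, ∃ G, 0 ≤ G ∧ WeylBound t (1 / (n + 2 : ℝ)) G := by
    intro n
    refine ae_norm_sum_gaussWeight_le (by positivity) ?_
    rw [div_lt_one (by positivity)]
    linarith [(Nat.cast_nonneg n : (0 : ℝ) ≤ n)]
  filter_upwards [ae_all_iff.2 h] with t ht δ hδ0 _
  obtain ⟨n, hn⟩ := exists_nat_one_div_lt hδ0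
  obtain ⟨G, hG, hw⟩ := ht n
  refine ⟨G, hG, fun a k x => (hw a k x).trans ?_⟩
  rcases Nat.eq_zero_or_pos k with rfl | hk
  · rw [Nat.cast_zero, Real.zero_rpow (by positivity), Real.zero_rpow (by positivity)]
  · gcongr
    · exact_mod_cast hk
    · refine le_trans ?_ hn.le
      gcongr
      norm_num

/-! ### Box dimension, covers and the upper bound for Hölder graphs -/

theorem log_one_div_pos_of_lt_one {ε : ℝ≥0} (h0 : 0 < ε) (h1 : ε < 1) :
    0 < Real.log (1 / (ε : ℝ)) := by
  apply Real.log_pos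
  rw [lt_div_iff₀ (by exact_mod_cast h0), one_mul]
  exact_mod_cast h1

theorem log_ofReal_rpow_neg {ε : ℝ≥0} (h0 : 0 < ε) (D : ℝ) :
    ENNReal.log (ENNReal.ofReal ((ε : ℝ) ^ (-D))) =
      ((Real.log (1 / (ε : ℝ)) : ℝ) : EReal) * (D : EReal) := by
  have h0' : (0 : ℝ) < ε := by exact_mod_cast h0
  rw [ENNReal.log_ofReal_of_pos (by positivity), Real.log_rpow h0', one_div, Real.log_inv,
    ← EReal.coe_mul]
  congr 1
  ring

/-- A polynomial bound on the size of covers bounds the upper box dimension. -/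
theorem upperBoxDim_le_of_forall_isCover {X : Type*} [PseudoEMetricSpace X] {E : Set X} {K D : ℝ}
    (h : ∀ ε : ℝ≥0, 0 < ε → ε < 1 →
      ∃ T : Finset X, Metric.IsCover (ε / 2) E T ∧ (T.card : ℝ) ≤ K * (ε : ℝ) ^ (-D)) :
    upperBoxDim E ≤ (D : EReal) := by
  rw [← EReal.le_of_forall_lt_iff_le]
  intro z hz
  have hz' : 0 < z - D := sub_pos.2 (EReal.coe_lt_coe_iff.1 hz)
  refine limsup_le_of_le (by isBoundedDefault) ?_
  -- For z > D the factor ε^{z-D} tends to 0 and absorbs the constant K.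
  have hlim : Tendsto (fun ε : ℝ≥0 => K * (ε : ℝ) ^ (z - D)) (𝓝[>] 0) (𝓝 (K * 0)) := by
    refine Tendsto.const_mul _ ?_
    have h1 : Tendsto (fun ε : ℝ≥0 => (ε : ℝ)) (𝓝[>] 0) (𝓝 ((0 : ℝ≥0) : ℝ)) :=
      (NNReal.continuous_coe.tendsto 0).mono_left nhdsWithin_le_nhds
    have h2 := h1.rpow_const (p := z - D) (Or.inr hz'.le)
    simpa [Real.zero_rpow hz'.ne'] using h2
  rw [mul_zero] at hlim
  filter_upwards [hlim.eventually_lt_const one_pos, self_mem_nhdsWithin,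
    Ioo_mem_nhdsGT (zero_lt_one (α := ℝ≥0))] with ε hε h0 h1
  have h0' : (0 : ℝ) < ε := by exact_mod_cast h0
  have hlog := log_one_div_pos_of_lt_one h0 h1.2
  rw [EReal.div_le_iff_le_mul (by exact_mod_cast hlog) (EReal.coe_ne_top _),
    ← log_ofReal_rpow_neg h0, ENNReal.log_le_log_iff]
  obtain ⟨T, hT, hcard⟩ := h ε h0 h1.2
  have hle := hT.externalCoveringNumber_le_encard
  rw [Set.encard_coe_eq_coe_finsetCard] at hle
  calc ((Metric.externalCoveringNumber (ε / 2) E : ℕ∞) : ℝ≥0∞) ≤ ((T.card : ℕ∞) : ℝ≥0∞) := by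
        exact_mod_cast hle
    _ = ENNReal.ofReal (T.card : ℝ) := by simp
    _ ≤ _ := by
        refine ENNReal.ofReal_le_ofReal (hcard.trans ?_)
        calc K * (ε : ℝ) ^ (-D) = (K * (ε : ℝ) ^ (z - D)) * (ε : ℝ) ^ (-z) := by
              rw [mul_assoc, ← Real.rpow_add h0']; ring_nf
          _ ≤ 1 * (ε : ℝ) ^ (-z) := by gcongr
          _ = _ := one_mul _

/-- A bound on the upper box dimension yields small covers at all small scales. -/
theorem exists_isCover_of_upperBoxDim_lt {X : Type*} [PseudoEMetricSpace X] {E : Set X} {D : ℝ}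
    (h : upperBoxDim E < (D : EReal)) :
    ∃ ε₀ : ℝ≥0, 0 < ε₀ ∧ ∀ ε : ℝ≥0, 0 < ε → ε < ε₀ →
      ∃ T : Finset X, Metric.IsCover (ε / 2) E T ∧ (T.card : ℝ) ≤ (ε : ℝ) ^ (-D) := by
  have h1 := eventually_lt_of_limsup_lt h
  have h2 := h1.and (Ioo_mem_nhdsGT (zero_lt_one (α := ℝ≥0)))
  obtain ⟨u, hu, hsub⟩ := mem_nhdsGT_iff_exists_Ioo_subset.1 h2
  refine ⟨u, hu, fun ε h0 hεu => ?_⟩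
  obtain ⟨hlt, -, hε1⟩ := hsub ⟨h0, hεu⟩
  have h0' : (0 : ℝ) < ε := by exact_mod_cast h0
  have hlog := log_one_div_pos_of_lt_one h0 hε1
  rw [EReal.div_lt_iff (by exact_mod_cast hlog) (EReal.coe_ne_top _), mul_comm,
    ← log_ofReal_rpow_neg h0, ENNReal.log_lt_log_iff] at hlt
  have hne : Metric.externalCoveringNumber (ε / 2) E ≠ ⊤ := by
    intro htop
    rw [htop] at hlt
    simp at hlt
  obtain ⟨n, hn⟩ := ENat.ne_top_iff_exists.1 hne
  -- Being below n + 1, the infimum is undercut by an actual cover, which then has at most n points.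
  have h3 : Metric.externalCoveringNumber (ε / 2) E < ((n + 1 : ℕ) : ℕ∞) := by
    rw [← hn]
    exact_mod_cast Nat.lt_succ_self n
  simp only [Metric.externalCoveringNumber, iInf_lt_iff] at h3
  obtain ⟨S, hS, hSn⟩ := h3
  have hfin : S.Finite := Set.finite_of_encard_le_coe hSn.le
  refine ⟨hfin.toFinset, by simpa using hS, ?_⟩
  rw [hfin.encard_eq_coe_toFinset_card] at hSn
  have h4 : hfin.toFinset.card ≤ n := Nat.lt_succ_iff.1 (by exact_mod_cast hSn)
  rw [← hn] at hlt
  have h5 : ENNReal.ofReal (n : ℝ) < ENNReal.ofReal ((ε : ℝ) ^ (-D)) := by simpa using hlt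
  rw [ENNReal.ofReal_lt_ofReal_iff (by positivity)] at h5
  exact le_trans (by exact_mod_cast h4) h5.le

theorem norm_coe_unitAddCircle_le (r : ℝ) : ‖(r : UnitAddCircle)‖ ≤ |r| := by
  rw [UnitAddCircle.norm_eq]
  simpa using round_le r 0

/-- The points of the torus whose coordinates are multiples of `1 / n`. -/
noncomputable def torusGrid (n : ℕ) : Finset Torus2 :=
  (Finset.range n ×ˢ Finset.range n).image fun z =>
    ![((z.1 / n : ℝ) : UnitAddCircle), ((z.2 / n : ℝ) : UnitAddCircle)]

theorem card_torusGrid_le (n : ℕ) : (torusGrid n).card ≤ n ^ 2 := by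
  refine Finset.card_image_le.trans ?_
  simp [sq]

theorem exists_dist_div_le {n : ℕ} (hn : 0 < n) (x : UnitAddCircle) :
    ∃ j ∈ Finset.range n, dist x ((j / n : ℝ) : UnitAddCircle) ≤ 1 / n := by
  have hn' : (0 : ℝ) < n := by exact_mod_cast hn
  obtain ⟨r, ⟨hr0, hr1⟩, rfl⟩ : ∃ r ∈ Set.Ico (0 : ℝ) (0 + 1), (r : UnitAddCircle) = x := by
    have : x ∈ ((↑) : ℝ → UnitAddCircle) '' Set.Ico (0 : ℝ) (0 + 1) := by
      rw [AddCircle.coe_image_Ico_eq]; trivial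
    simpa using this
  have hrn : 0 ≤ r * n := by positivity
  refine ⟨⌊r * n⌋₊, ?_, ?_⟩
  · rw [Finset.mem_range, Nat.floor_lt hrn]
    nlinarith
  · rw [dist_eq_norm, ← AddCircle.coe_sub]
    refine (norm_coe_unitAddCircle_le _).trans ?_
    have h1 := Nat.floor_le hrn
    have h2 := Nat.lt_floor_add_one (r * n)
    have e : r - ⌊r * n⌋₊ / n = (r * n - ⌊r * n⌋₊) / n := by field_simp
    rw [e, abs_div, abs_of_pos hn', abs_of_nonneg (by linarith)]
    gcongr
    linarith

theorem exists_mem_torusGrid_dist_le {n : ℕ} (hn : 0 < n) (x : Torus2) :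
    ∃ p ∈ torusGrid n, dist x p ≤ 1 / n := by
  obtain ⟨j, hj, hj'⟩ := exists_dist_div_le hn (x 0)
  obtain ⟨k, hk, hk'⟩ := exists_dist_div_le hn (x 1)
  refine ⟨_, Finset.mem_image.2 ⟨(j, k), Finset.mem_product.2 ⟨hj, hk⟩, rfl⟩, ?_⟩
  rw [dist_pi_le_iff (by positivity), Fin.forall_fin_two]
  exact ⟨hj', hk'⟩

/-- The graph of a Hölder function on the two-dimensional torus has upper box dimension at most
three minus the Hölder exponent. -/
theorem upperBoxDim_graphOn_le_of_holder {g : Torus2 → ℝ} {C γ : ℝ} (hC : 0 ≤ C) (hγ0 : 0 ≤ γ)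
    (hγ1 : γ ≤ 1) (hg : ∀ x y, |g x - g y| ≤ C * dist x y ^ γ) :
    upperBoxDim (Set.graphOn g Set.univ) ≤ ((3 - γ : ℝ) : EReal) := by
  refine upperBoxDim_le_of_forall_isCover (K := 9 * (4 * C + 3)) fun ε h0 h1 => ?_
  have h0' : (0 : ℝ) < ε := by exact_mod_cast h0
  have h1' : (ε : ℝ) < 1 := by exact_mod_cast h1
  set n := ⌈2 / (ε : ℝ)⌉₊ with hn
  have hn1 : 2 / (ε : ℝ) ≤ n := Nat.le_ceil _
  have hn0' : (0 : ℝ) < n := lt_of_lt_of_le (by positivity) hn1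
  have hn0 : 0 < n := by exact_mod_cast hn0'
  have hn2 : (n : ℝ) ≤ 3 / ε := by
    have := (Nat.ceil_lt_add_one (by positivity : 0 ≤ 2 / (ε : ℝ))).le
    have h2 : 1 ≤ 1 / (ε : ℝ) := by rw [le_div_iff₀ h0']; linarith
    calc (n : ℝ) ≤ 2 / ε + 1 := this
      _ ≤ 2 / ε + 1 / ε := by gcongr
      _ = 3 / ε := by ring
  have hnε : 1 / (n : ℝ) ≤ ε / 2 := by
    rw [div_le_iff₀ h0'] at hn1
    rw [div_le_div_iff₀ hn0' (by norm_num)]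
    linarith
  -- Within ε/2 of a grid point g varies by at most Cε^γ, which is 2Cε^{γ-1} steps of height ε/2.
  -- The 2M + 1 heights over each of n² grid points give the count ε^{-2} ε^{γ-1}, up to constants.
  set M := ⌈2 * C * (ε : ℝ) ^ (γ - 1)⌉₊ with hM
  have hP : 1 ≤ (ε : ℝ) ^ (γ - 1) :=
    Real.one_le_rpow_of_pos_of_le_one_of_nonpos h0' h1'.le (by linarith)
  have hM1 : 2 * C * (ε : ℝ) ^ (γ - 1) ≤ M := Nat.le_ceil _
  have hM2 : (M : ℝ) ≤ 2 * C * (ε : ℝ) ^ (γ - 1) + 1 :=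
    (Nat.ceil_lt_add_one (by positivity)).le
  refine ⟨(torusGrid n ×ˢ Finset.Icc (-(M : ℤ)) M).image
    fun z => (z.1, g z.1 + ε / 2 * z.2), ?_, ?_⟩
  · rintro ⟨x, y⟩ hxy
    simp only [Set.mem_graphOn, Set.mem_univ, true_and] at hxy
    obtain ⟨p, hp, hxp⟩ := exists_mem_torusGrid_dist_le hn0 x
    have hxp' : dist x p ≤ ε / 2 := hxp.trans hnε
    have hd : |g x - g p| ≤ C * (ε : ℝ) ^ γ := by
      refine (hg x p).trans ?_
      gcongr
      linarith
    set i := ⌊(g x - g p) / (ε / 2)⌋ with hi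
    have e1 : (ε : ℝ) ^ γ = ε * (ε : ℝ) ^ (γ - 1) := by
      rw [Real.rpow_sub_one h0'.ne']; field_simp
    have hq : |(g x - g p) / (ε / 2)| ≤ M := by
      rw [abs_div, abs_of_pos (by positivity : (0 : ℝ) < ε / 2), div_le_iff₀ (by positivity)]
      calc _ ≤ C * (ε : ℝ) ^ γ := hd
        _ = 2 * C * (ε : ℝ) ^ (γ - 1) * (ε / 2) := by rw [e1]; ring
        _ ≤ _ := by gcongr
    rw [abs_le] at hq
    have hi1 : -(M : ℤ) ≤ i := by
      rw [hi, Int.le_floor]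
      push_cast
      exact hq.1
    have hi2 : i ≤ M := by
      have : (i : ℝ) ≤ M := (Int.floor_le _).trans hq.2
      exact_mod_cast this
    refine ⟨(p, g p + ε / 2 * i), ?_, ?_⟩
    · simp only [Finset.coe_image, Set.mem_image, Finset.mem_coe, Finset.mem_product,
        Finset.mem_Icc]
      exact ⟨(p, i), ⟨hp, hi1, hi2⟩, rfl⟩
    · have hdist : dist (x, y) (p, g p + ε / 2 * i) ≤ ((ε / 2 : ℝ≥0) : ℝ) := by
        rw [Prod.dist_eq, max_le_iff]
        push_cast
        refine ⟨hxp', ?_⟩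
        rw [← hxy, Real.dist_eq]
        have e2 : g x - (g p + ε / 2 * i) = ((g x - g p) / (ε / 2) - i) * (ε / 2) := by
          field_simp; ring
        have h3 := Int.floor_le ((g x - g p) / (ε / 2))
        have h4 := Int.lt_floor_add_one ((g x - g p) / (ε / 2))
        rw [e2, abs_mul, abs_of_pos (by positivity : (0 : ℝ) < ε / 2),
          abs_of_nonneg (by rw [hi]; linarith)]
        refine mul_le_of_le_one_left (by positivity) ?_
        rw [hi]
        linarith
      change edist _ _ ≤ _
      rw [edist_dist, ← ENNReal.ofReal_coe_nnreal]
      exact ENNReal.ofReal_le_ofReal hdist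
  · have hc : ((torusGrid n ×ˢ Finset.Icc (-(M : ℤ)) M).image
        (fun z => (z.1, g z.1 + ε / 2 * z.2))).card ≤ n ^ 2 * (2 * M + 1) := by
      refine Finset.card_image_le.trans ?_
      rw [Finset.card_product, Int.card_Icc]
      gcongr
      · exact card_torusGrid_le n
      · omega
    calc _ ≤ ((n ^ 2 * (2 * M + 1) : ℕ) : ℝ) := by exact_mod_cast hc
      _ = (n : ℝ) ^ 2 * (2 * M + 1) := by push_cast; ring
      _ ≤ (3 / ε) ^ 2 * ((4 * C + 3) * (ε : ℝ) ^ (γ - 1)) := by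
          gcongr
          nlinarith
      _ = 9 * (4 * C + 3) * ((ε : ℝ) ^ (γ - 1) / ε ^ 2) := by field_simp; ring
      _ = _ := by
          rw [show -(3 - γ) = γ - 1 - (2 : ℕ) by push_cast; ring,
            Real.rpow_sub_natCast h0'.ne']

theorem graphDim_le_of_holder {v : Torus2 → ℂ} {s : ℝ} (hs : 0 < s) (hs1 : s < 1)
    (hv : ∀ γ : ℝ≥0, (γ : ℝ) < s → ∃ C : ℝ≥0, HolderWith C γ v) :
    graphDim v ≤ ((3 - s : ℝ) : EReal) := by
  have key : ∀ γ : ℝ≥0, (γ : ℝ) < s → graphDim v ≤ ((3 - γ : ℝ) : EReal) := by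
    intro γ hγ
    obtain ⟨C, hC⟩ := hv γ hγ
    have hd : ∀ x y, ‖v x - v y‖ ≤ C * dist x y ^ (γ : ℝ) := fun x y => by
      rw [← dist_eq_norm]; exact hC.dist_le x y
    refine max_le ?_ ?_
    · refine upperBoxDim_graphOn_le_of_holder C.coe_nonneg γ.coe_nonneg (by linarith)
        fun x y => ?_
      rw [← Complex.sub_re]
      exact (Complex.abs_re_le_norm _).trans (hd x y)
    · refine upperBoxDim_graphOn_le_of_holder C.coe_nonneg γ.coe_nonneg (by linarith)
        fun x y => ?_
      rw [← Complex.sub_im]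
      exact (Complex.abs_im_le_norm _).trans (hd x y)
  rw [← EReal.le_of_forall_lt_iff_le]
  intro z hz
  have hz' : 3 - s < z := EReal.coe_lt_coe_iff.1 hz
  -- The exponent 3 - z is below s and gives the bound z; the maximum with 0 covers z > 3.
  refine (key ⟨max 0 (3 - z), le_max_left _ _⟩ (max_lt hs (by linarith))).trans ?_
  rw [EReal.coe_le_coe_iff]
  change 3 - max 0 (3 - z) ≤ z
  linarith [le_max_right 0 (3 - z)]

/-! ### From covers of the graph to the L¹ modulus of continuity -/

theorem torusMeasure_closedBall_le (p : Torus2) {r : ℝ} (hr : 0 ≤ r) :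
    torusMeasure (Metric.closedBall p r) ≤ ENNReal.ofReal ((2 * r) ^ 2) := by
  have h : ∀ x : UnitAddCircle,
      AddCircle.haarAddCircle (Metric.closedBall x r) ≤ ENNReal.ofReal (2 * r) := by
    intro x
    have := AddCircle.volume_closedBall (T := 1) (x := x) r
    rw [AddCircle.volume_eq_smul_haarAddCircle] at this
    simp only [ENNReal.ofReal_one, one_smul] at this
    rw [this]
    exact ENNReal.ofReal_le_ofReal (min_le_right _ _)
  rw [torusMeasure, Measure.pi_closedBall _ _ hr, Fin.prod_univ_two, sq,
    ENNReal.ofReal_mul (by positivity)]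
  exact mul_le_mul' (h _) (h _)

/-- The `L¹` modulus of continuity of a function is controlled by the covers of its graph. -/
theorem lintegral_enorm_sub_le_of_isCover {g : Torus2 → ℝ} (hg : Continuous g) {ε : ℝ≥0}
    {T : Finset (Torus2 × ℝ)} (hT : Metric.IsCover (ε / 2) (Set.graphOn g Set.univ) T)
    (i : Fin 2) :
    ∫⁻ x, ‖g (x + Pi.single i ((ε : ℝ) : UnitAddCircle)) - g x‖ₑ ∂torusMeasure ≤
      ENNReal.ofReal (9 * T.card * (ε : ℝ) ^ 3) := by
  classical
  have hε : (0 : ℝ) ≤ ε := ε.coe_nonneg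
  -- The radius is the length ε of the segment plus the radius ε/2 of a covering ball.
  set B : Torus2 × ℝ → Set Torus2 := fun c => Metric.closedBall c.1 (3 / 2 * ε)
  have hpt : ∀ x, ‖g (x + Pi.single i ((ε : ℝ) : UnitAddCircle)) - g x‖ₑ ≤
      ∑ c ∈ T, (B c).indicator (fun _ => ENNReal.ofReal ε) x := by
    intro x
    set φ : ℝ → ℝ := fun τ => g (x + Pi.single i (τ : UnitAddCircle)) with hφ
    have hφc : Continuous φ := by
      refine hg.comp (continuous_const.add ?_)
      exact (continuous_single i).comp (AddCircle.continuous_mk' 1)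
    have hφ0 : φ 0 = g x := by simp [hφ]
    -- Every height between the two end values is attained on the segment, at a graph point lying in
    -- some box near x. The vertical sides of those boxes, each of length ε, thus cover the
    -- interval.
    have hsub : Set.uIcc (φ 0) (φ ε) ⊆
        ⋃ c ∈ T.filter (fun c => x ∈ B c), Metric.closedBall c.2 (ε / 2) := by
      intro y hy
      obtain ⟨τ, hτ, rfl⟩ := intermediate_value_uIcc hφc.continuousOn hy
      rw [Set.uIcc_of_le hε] at hτ
      obtain ⟨c, hc, hdc⟩ := hT (x := (x + Pi.single i (τ : UnitAddCircle), φ τ))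
        (by simp [hφ])
      change edist _ _ ≤ _ at hdc
      rw [edist_dist, ← ENNReal.ofReal_coe_nnreal,
        ENNReal.ofReal_le_ofReal_iff NNReal.zero_le_coe, Prod.dist_eq, max_le_iff] at hdc
      push_cast at hdc
      have hx : dist x (x + Pi.single i (τ : UnitAddCircle)) ≤ ε := by
        rw [dist_eq_norm, sub_add_cancel_left, norm_neg, Pi.norm_single]
        refine (norm_coe_unitAddCircle_le _).trans ?_
        rw [abs_of_nonneg hτ.1]
        exact hτ.2
      simp only [Set.mem_iUnion, Finset.mem_filter]
      refine ⟨c, ⟨hc, ?_⟩, hdc.2⟩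
      rw [Metric.mem_closedBall]
      have := dist_triangle x (x + Pi.single i (τ : UnitAddCircle)) c.1
      linarith [hdc.1]
    have hvol := (measure_mono hsub).trans (measure_biUnion_finset_le (μ := volume) _ _)
    rw [Real.volume_interval, hφ0] at hvol
    rw [← ofReal_norm, Real.norm_eq_abs]
    refine hvol.trans (le_of_eq ?_)
    rw [Finset.sum_filter]
    refine Finset.sum_congr rfl fun c _ => ?_
    rw [Real.volume_closedBall, Set.indicator_apply]
    congr 2
    ring
  refine (lintegral_mono hpt).trans ?_
  rw [lintegral_finsetSum _ fun c _ =>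
    measurable_const.indicator Metric.isClosed_closedBall.measurableSet]
  -- A box counts only for x in a square of measure at most (3ε)², and then adds ε.
  have hc : ∀ c ∈ T, ∫⁻ x, (B c).indicator (fun _ => ENNReal.ofReal ε) x ∂torusMeasure ≤
      ENNReal.ofReal (9 * (ε : ℝ) ^ 3) := by
    intro c _
    rw [lintegral_indicator_const Metric.isClosed_closedBall.measurableSet]
    refine (mul_le_mul_right (torusMeasure_closedBall_le c.1 (by positivity)) _).trans (le_of_eq ?_)
    rw [← ENNReal.ofReal_mul hε]
    congr 1
    ring
  refine (Finset.sum_le_card_nsmul _ _ _ hc).trans (le_of_eq ?_)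
  rw [nsmul_eq_mul, ← ENNReal.ofReal_natCast, ← ENNReal.ofReal_mul (by positivity)]
  congr 1
  ring

/-! ### Translations, dyadic shells and Sobolev regularity -/

theorem memLp_torusMeasure (v : C(Torus2, ℂ)) : MemLp v 2 torusMeasure :=
  MemLp.of_bound v.continuous.aestronglyMeasurable ‖v‖
    (Eventually.of_forall fun x => v.norm_coe_le_norm x)

theorem mFourier_add_right (m : Fin 2 → ℤ) (x y : Torus2) :
    UnitAddTorus.mFourier m (x + y) = UnitAddTorus.mFourier m x * UnitAddTorus.mFourier m y := by
  simp only [UnitAddTorus.mFourier, ContinuousMap.coe_mk, ← Finset.prod_mul_distrib, Pi.add_apply,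
    fourier_apply, smul_add, AddCircle.toCircle_add, Circle.coe_mul]

theorem mFourier_neg_mul_self (m : Fin 2 → ℤ) (x : Torus2) :
    UnitAddTorus.mFourier (-m) x * UnitAddTorus.mFourier m x = 1 := by
  rw [← UnitAddTorus.mFourier_add, neg_add_cancel, UnitAddTorus.mFourier_zero,
    ContinuousMap.one_apply]

theorem mFourierCoeff_translate_sub (v : C(Torus2, ℂ)) (h : Torus2) (m : Fin 2 → ℤ) :
    UnitAddTorus.mFourierCoeff (fun x => v (x + h) - v x) m =
      (UnitAddTorus.mFourier m h - 1) * UnitAddTorus.mFourierCoeff v m := by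
  have hint : ∀ g : Torus2 → ℂ, Continuous g → Integrable g torusMeasure := fun g hg =>
    (BoundedContinuousFunction.mkOfCompact ⟨g, hg⟩).integrable torusMeasure
  have h1 : ∫ x, UnitAddTorus.mFourier (-m) x * v (x + h) ∂torusMeasure =
      UnitAddTorus.mFourier m h * ∫ x, UnitAddTorus.mFourier (-m) x * v x ∂torusMeasure := by
    rw [← integral_const_mul,
      ← integral_add_right_eq_self
        (fun x => UnitAddTorus.mFourier m h * (UnitAddTorus.mFourier (-m) x * v x)) h]
    refine integral_congr_ae (Eventually.of_forall fun x => ?_)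
    have := mFourier_neg_mul_self m h
    simp only [mFourier_add_right]
    linear_combination (-(UnitAddTorus.mFourier (-m) x * v (x + h))) * this
  change ∫ x, UnitAddTorus.mFourier (-m) x • (v (x + h) - v x) ∂torusMeasure =
    _ * ∫ x, UnitAddTorus.mFourier (-m) x • v x ∂torusMeasure
  simp only [smul_eq_mul, mul_sub]
  rw [integral_sub (hint _ (by fun_prop)) (hint _ (by fun_prop)), h1, sub_mul, one_mul]

theorem hasSum_translate_sub (v : C(Torus2, ℂ)) (h : Torus2) :
    HasSum (fun m => ‖UnitAddTorus.mFourier m h - 1‖ ^ 2 * ‖UnitAddTorus.mFourierCoeff v m‖ ^ 2)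
      (∫ x, ‖v (x + h) - v x‖ ^ 2 ∂torusMeasure) := by
  have := hasSum_sq_norm_mFourierCoeff
    (memLp_torusMeasure ⟨fun x => v (x + h) - v x, by fun_prop⟩)
  simpa only [ContinuousMap.coe_mk, mFourierCoeff_translate_sub, norm_mul, mul_pow] using this

/-- The norm is 2 sin(π|n|/(4N)) with argument in [π/4, π/2], where sin u ≥ 2u/π makes it at least
|n|/N. -/
theorem one_le_norm_fourier_sub_one {n : ℤ} {N : ℕ} (hN : 0 < N) (h1 : (N : ℤ) ≤ |n|)
    (h2 : |n| ≤ 2 * N) :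
    1 ≤ ‖fourier n ((1 / (4 * N) : ℝ) : UnitAddCircle) - 1‖ := by
  have hN0 : (0 : ℝ) < N := by exact_mod_cast hN
  have e : (2 * Real.pi * Complex.I * n * ((1 / (4 * N) : ℝ) : ℂ) / (1 : ℝ) : ℂ)
      = Complex.I * ((2 * Real.pi * n * (1 / (4 * N)) : ℝ) : ℂ) := by push_cast; ring
  rw [fourier_coe_apply, e, Complex.norm_exp_I_mul_ofReal_sub_one, norm_mul, Real.norm_ofNat,
    Real.norm_eq_abs]
  have h1' : (N : ℝ) ≤ |(n : ℝ)| := by exact_mod_cast h1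
  have h2' : |(n : ℝ)| ≤ 2 * N := by exact_mod_cast h2
  have hpi := Real.pi_pos
  have hu : |2 * Real.pi * n * (1 / (4 * N)) / 2| = Real.pi / 4 * (|(n : ℝ)| / N) := by
    rw [show 2 * Real.pi * n * (1 / (4 * N)) / 2 = Real.pi / 4 * (n / N) by field_simp,
      abs_mul (Real.pi / 4), abs_div (n : ℝ), abs_of_pos (by positivity : 0 < Real.pi / 4),
      abs_of_pos hN0]
  have hq1 : 1 ≤ |(n : ℝ)| / N := by rwa [one_le_div hN0]
  have hq2 : |(n : ℝ)| / N ≤ 2 := by rwa [div_le_iff₀ hN0]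
  have := Real.mul_abs_le_abs_sin (x := 2 * Real.pi * n * (1 / (4 * N)) / 2)
    (by rw [hu]; nlinarith)
  rw [hu] at this
  have e2 : 2 / Real.pi * (Real.pi / 4 * (|(n : ℝ)| / N)) = |(n : ℝ)| / N / 2 := by
    field_simp; ring
  rw [e2] at this
  linarith

/-- The frequencies in the dyadic shell at scale `N` are seen by translations of length
`1 / (4 N)` along the coordinate axes. -/
theorem sum_shell_le (v : C(Torus2, ℂ)) {N : ℕ} (hN : 0 < N) :
    ∑ m ∈ latticeBox (2 * N) \ latticeBox N, ‖UnitAddTorus.mFourierCoeff v m‖ ^ 2 ≤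
      ∑ i, ∫ x, ‖v (x + Pi.single i ((1 / (4 * N) : ℝ) : UnitAddCircle)) - v x‖ ^ 2
        ∂torusMeasure := by
  have h1 : ∀ i : Fin 2, ∑ m ∈ latticeBox (2 * N) \ latticeBox N,
      ‖UnitAddTorus.mFourier m (Pi.single i ((1 / (4 * N) : ℝ) : UnitAddCircle)) - 1‖ ^ 2 *
        ‖UnitAddTorus.mFourierCoeff v m‖ ^ 2 ≤
      ∫ x, ‖v (x + Pi.single i ((1 / (4 * N) : ℝ) : UnitAddCircle)) - v x‖ ^ 2 ∂torusMeasure :=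
    fun i => sum_le_hasSum _ (fun m _ => by positivity) (hasSum_translate_sub v _)
  refine le_trans ?_ (Finset.sum_le_sum fun i _ => h1 i)
  rw [Finset.sum_comm]
  refine Finset.sum_le_sum fun m hm => ?_
  rw [← Finset.sum_mul]
  refine le_mul_of_one_le_left (by positivity) ?_
  have hsingle : ∀ (i : Fin 2) (z : UnitAddCircle),
      UnitAddTorus.mFourier m (Pi.single i z) = fourier (m i) z := by
    intro i z
    fin_cases i <;> simp [UnitAddTorus.mFourier, Fin.prod_univ_two]
  have hi : ∃ i, (N : ℤ) ≤ |m i| ∧ |m i| ≤ 2 * N := by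
    rw [Finset.mem_sdiff, mem_latticeBox, mem_latticeBox] at hm
    obtain ⟨h2, h3⟩ := hm
    push Not at h3
    obtain ⟨i, hi⟩ := h3
    have := h2 i
    refine ⟨i, ?_, ?_⟩
    · rw [le_abs]; omega
    · rw [abs_le]; omega
  obtain ⟨i, hi1, hi2⟩ := hi
  refine le_trans ?_ (Finset.single_le_sum (f := fun i =>
    ‖UnitAddTorus.mFourier m (Pi.single i ((1 / (4 * N) : ℝ) : UnitAddCircle)) - 1‖ ^ 2)
    (fun j _ => by positivity) (Finset.mem_univ i))
  simp only [hsingle]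
  exact one_le_pow₀ (one_le_norm_fourier_sub_one hN hi1 hi2)

/-- Square-integrable modulus of continuity of a Hölder function whose graph has small covers. -/
theorem integral_sq_translate_sub_le {v : C(Torus2, ℂ)} {K γ D : ℝ} (hK : 0 ≤ K)
    (hv : ∀ x y, ‖v x - v y‖ ≤ K * dist x y ^ γ) (hγ : 0 ≤ γ) {ε : ℝ≥0} (hε : 0 < ε)
    {T₁ T₂ : Finset (Torus2 × ℝ)}
    (hT₁ : Metric.IsCover (ε / 2) (Set.graphOn (fun x => (v x).re) Set.univ) T₁)
    (hT₂ : Metric.IsCover (ε / 2) (Set.graphOn (fun x => (v x).im) Set.univ) T₂)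
    (hc₁ : (T₁.card : ℝ) ≤ (ε : ℝ) ^ (-D)) (hc₂ : (T₂.card : ℝ) ≤ (ε : ℝ) ^ (-D)) (i : Fin 2) :
    ∫ x, ‖v (x + Pi.single i ((ε : ℝ) : UnitAddCircle)) - v x‖ ^ 2 ∂torusMeasure ≤
      18 * K * (ε : ℝ) ^ (γ + 3 - D) := by
  have hε0 : (0 : ℝ) < ε := by exact_mod_cast hε
  set h : Torus2 := Pi.single i ((ε : ℝ) : UnitAddCircle) with hh
  set P := (ε : ℝ) ^ (-D) with hP
  have hP0 : 0 ≤ P := by positivity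
  have hre := lintegral_enorm_sub_le_of_isCover (Complex.continuous_re.comp v.continuous) hT₁ i
  have him := lintegral_enorm_sub_le_of_isCover (Complex.continuous_im.comp v.continuous) hT₂ i
  simp only [Function.comp_apply, ← hh] at hre him
  have hmono : ∀ {c : ℝ}, c ≤ P → ENNReal.ofReal (9 * c * (ε : ℝ) ^ 3) ≤
      ENNReal.ofReal (9 * P * (ε : ℝ) ^ 3) := fun hc => by gcongr
  have hsup : ∀ x, ‖v (x + h) - v x‖ ≤ K * (ε : ℝ) ^ γ := by
    intro x
    refine (hv _ _).trans ?_
    gcongr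
    rw [dist_eq_norm, add_sub_cancel_left, hh, Pi.norm_single]
    refine (norm_coe_unitAddCircle_le _).trans ?_
    rw [abs_of_pos hε0]
  -- One factor of the square is bounded by the Hölder estimate, the other by its real and imaginary
  -- parts, whose L¹ norms the covers control.
  have hpt : ∀ x, ENNReal.ofReal (‖v (x + h) - v x‖ ^ 2) ≤ ENNReal.ofReal (K * (ε : ℝ) ^ γ) *
      (‖(v (x + h)).re - (v x).re‖ₑ + ‖(v (x + h)).im - (v x).im‖ₑ) := by
    intro x
    rw [← ofReal_norm, ← ofReal_norm, ← ENNReal.ofReal_add (norm_nonneg _) (norm_nonneg _),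
      ← ENNReal.ofReal_mul (by positivity), sq]
    refine ENNReal.ofReal_le_ofReal ?_
    have := Complex.norm_le_abs_re_add_abs_im (v (x + h) - v x)
    rw [Complex.sub_re, Complex.sub_im] at this
    exact mul_le_mul (hsup x) this (norm_nonneg _) (by positivity)
  have hlint : ∫⁻ x, ENNReal.ofReal (‖v (x + h) - v x‖ ^ 2) ∂torusMeasure ≤
      ENNReal.ofReal (18 * K * (ε : ℝ) ^ (γ + 3 - D)) := by
    refine (lintegral_mono hpt).trans ?_
    rw [lintegral_const_mul _ (Continuous.measurable (by fun_prop)),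
      lintegral_add_left (Continuous.measurable (by fun_prop))]
    refine (mul_le_mul_right (add_le_add (hre.trans (hmono hc₁)) (him.trans (hmono hc₂))) _).trans
      (le_of_eq ?_)
    rw [← ENNReal.ofReal_add (by positivity) (by positivity), ← ENNReal.ofReal_mul (by positivity)]
    congr 1
    have : (ε : ℝ) ^ (γ + 3 - D) = (ε : ℝ) ^ γ * (ε : ℝ) ^ 3 * P := by
      rw [hP, ← Real.rpow_natCast, ← Real.rpow_add hε0, ← Real.rpow_add hε0]
      norm_num [sub_eq_add_neg]
    rw [this]
    ring
  rw [integral_eq_lintegral_of_nonneg_ae (Eventually.of_forall fun x => by positivity)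
    (Continuous.aestronglyMeasurable (by fun_prop))]
  exact ENNReal.toReal_le_of_le_ofReal (by positivity) hlint

theorem bracket_le_of_mem_latticeBox {N : ℕ} (hN : 0 < N) {m : Fin 2 → ℤ}
    (hm : m ∈ latticeBox (2 * N)) : bracket m ≤ 3 * N := by
  have hN' : (1 : ℝ) ≤ N := by exact_mod_cast hN
  rw [mem_latticeBox] at hm
  have h : ∀ i, (m i : ℝ) ^ 2 ≤ (2 * N) ^ 2 := by
    intro i
    have h1 : -(2 * N : ℤ) ≤ m i := by have := hm i; push_cast at this; omega
    have h2 : m i ≤ 2 * N := by have := hm i; push_cast at this; omega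
    exact sq_le_sq' (by exact_mod_cast h1) (by exact_mod_cast h2)
  rw [bracket, latticeNormSq, Real.sqrt_le_left (by positivity)]
  nlinarith [h 0, h 1]

/-- Decay of the `ℓ²` norm on dyadic shells gives Sobolev regularity. -/
theorem summable_bracket_of_shell {b : (Fin 2 → ℤ) → ℝ} (hb : ∀ m, 0 ≤ b m) {K β r : ℝ} {J : ℕ}
    (hK : 0 ≤ K) (hr0 : 0 ≤ r) (hr : 2 * r < β)
    (h : ∀ j, J ≤ j → ∑ m ∈ latticeBox (2 * 2 ^ j) \ latticeBox (2 ^ j), b m ≤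
      K * ((2 ^ j : ℕ) : ℝ) ^ (-β)) :
    Summable fun m => bracket m ^ (2 * r) * b m := by
  -- On the shell at N = 2^j the weight is at most (3N)^{2r}, so the weighted shell sums decay
  -- geometrically with ratio ρ < 1.
  set ρ : ℝ := (2 : ℝ) ^ (2 * r - β) with hρ
  have hρ0 : 0 ≤ ρ := by positivity
  have hρ1 : ρ < 1 := Real.rpow_lt_one_of_one_lt_of_neg (by norm_num) (by linarith)
  set g : (Fin 2 → ℤ) → ℝ := fun m => bracket m ^ (2 * r) * b m with hg
  have hg0 : ∀ m, 0 ≤ g m := fun m =>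
    mul_nonneg (Real.rpow_nonneg (bracket_pos m).le _) (hb m)
  have hshell : ∀ j, J ≤ j → ∑ m ∈ latticeBox (2 * 2 ^ j) \ latticeBox (2 ^ j), g m ≤
      3 ^ (2 * r) * K * ρ ^ j := by
    intro j hj
    have hpos : (0 : ℝ) < ((2 ^ j : ℕ) : ℝ) := by positivity
    calc _ ≤ ∑ m ∈ latticeBox (2 * 2 ^ j) \ latticeBox (2 ^ j),
          (3 * ((2 ^ j : ℕ) : ℝ)) ^ (2 * r) * b m := by
          refine Finset.sum_le_sum fun m hm => ?_
          refine mul_le_mul_of_nonneg_right ?_ (hb m)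
          refine Real.rpow_le_rpow (bracket_pos m).le ?_ (by linarith)
          exact bracket_le_of_mem_latticeBox (by positivity) (Finset.mem_sdiff.1 hm).1
      _ = (3 * ((2 ^ j : ℕ) : ℝ)) ^ (2 * r) *
          ∑ m ∈ latticeBox (2 * 2 ^ j) \ latticeBox (2 ^ j), b m := by rw [Finset.mul_sum]
      _ ≤ (3 * ((2 ^ j : ℕ) : ℝ)) ^ (2 * r) * (K * ((2 ^ j : ℕ) : ℝ) ^ (-β)) := by
          gcongr
          exact h j hj
      _ = 3 ^ (2 * r) * K * (((2 ^ j : ℕ) : ℝ) ^ (2 * r) * ((2 ^ j : ℕ) : ℝ) ^ (-β)) := by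
          rw [Real.mul_rpow (by norm_num) hpos.le]; ring
      _ = _ := by
          rw [← Real.rpow_add hpos, ← sub_eq_add_neg, two_pow_cast_rpow, hρ]
  have hsub : ∀ j : ℕ, latticeBox (2 ^ j) ⊆ latticeBox (2 * 2 ^ j) := by
    intro j m hm
    rw [mem_latticeBox] at hm ⊢
    intro i
    have := hm i
    push_cast at this ⊢
    omega
  set B := ∑ m ∈ latticeBox (2 ^ J), g m with hB
  have hbox : ∀ n, ∑ m ∈ latticeBox (2 ^ (J + n)), g m ≤
      B + 3 ^ (2 * r) * K * ∑ i ∈ Finset.range n, ρ ^ (J + i) := by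
    intro n
    induction n with
    | zero => simp [hB]
    | succ n ih =>
      rw [← add_assoc, pow_succ', ← Finset.sum_sdiff (hsub (J + n)), Finset.sum_range_succ]
      have := hshell (J + n) (by omega)
      linarith
  refine summable_of_sum_le (c := B + 3 ^ (2 * r) * K * (1 - ρ)⁻¹) hg0 fun u => ?_
  obtain ⟨j, hju, hjJ⟩ := ((tendsto_latticeBox.eventually_ge_atTop u).and
    (eventually_ge_atTop J)).exists
  obtain ⟨n, rfl⟩ := Nat.exists_eq_add_of_le hjJ
  refine (Finset.sum_le_sum_of_subset_of_nonneg hju fun m _ _ => hg0 m).trans ((hbox n).trans ?_)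
  gcongr
  calc ∑ i ∈ Finset.range n, ρ ^ (J + i) ≤ ∑ i ∈ Finset.range n, ρ ^ i := by
        refine Finset.sum_le_sum fun i _ => ?_
        exact pow_le_pow_of_le_one hρ0 hρ1.le (by omega)
    _ ≤ _ := (tsum_geometric_of_lt_one hρ0 hρ1) ▸
      (summable_geometric_of_lt_one hρ0 hρ1).sum_le_tsum _ fun i _ => by positivity

/-- A Hölder function of every order below `s` whose graph has upper box dimension below `D` lies
in every Sobolev space of order below `(s + 3 - D) / 2`. -/
theorem summable_bracket_of_graphDim_lt {v : C(Torus2, ℂ)} {s D r : ℝ} (hs : 0 < s)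
    (hv : ∀ γ : ℝ≥0, (γ : ℝ) < s → ∃ K : ℝ≥0, HolderWith K γ v)
    (hD : graphDim v < (D : EReal)) (hr0 : 0 ≤ r) (hr : 2 * r < s + 3 - D) :
    Summable fun m => bracket m ^ (2 * r) * ‖UnitAddTorus.mFourierCoeff v m‖ ^ 2 := by
  obtain ⟨γ, hγ1, hγ2⟩ : ∃ γ : ℝ, max 0 (2 * r - 3 + D) < γ ∧ γ < s :=
    exists_between (max_lt hs (by linarith))
  have hγ0 : 0 ≤ γ := (le_max_left _ _).trans hγ1.le
  have hγr : 2 * r < γ + 3 - D := by linarith [le_max_right 0 (2 * r - 3 + D)]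
  obtain ⟨K, hK⟩ := hv ⟨γ, hγ0⟩ hγ2
  have hvd : ∀ x y, ‖v x - v y‖ ≤ K * dist x y ^ γ := fun x y => by
    rw [← dist_eq_norm]; exact hK.dist_le x y
  obtain ⟨ε₁, hε₁, hT₁⟩ := exists_isCover_of_upperBoxDim_lt ((le_max_left _ _).trans_lt hD)
  obtain ⟨ε₂, hε₂, hT₂⟩ := exists_isCover_of_upperBoxDim_lt ((le_max_right _ _).trans_lt hD)
  obtain ⟨J, hJ⟩ := exists_pow_lt_of_lt_one (lt_min hε₁ hε₂) (show (1 / 2 : ℝ≥0) < 1 by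
    rw [← NNReal.coe_lt_coe]; norm_num)
  -- The factor 36 is 18 for each of the two directions; the power of 4 comes from ε = 1/(4 · 2^j).
  refine summable_bracket_of_shell (K := 36 * K * 4 ^ (-(γ + 3 - D))) (β := γ + 3 - D) (J := J)
    (fun m => by positivity) (by positivity) hr0 hγr fun j hj => ?_
  have hpos : 0 < 2 ^ j := by positivity
  refine (sum_shell_le v hpos).trans ?_
  set ε : ℝ≥0 := 1 / (4 * 2 ^ j) with hε
  have hε0 : 0 < ε := by positivity
  have hεlt : ε < min ε₁ ε₂ := by
    refine lt_of_le_of_lt ?_ hJ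
    calc ε ≤ (1 / 2) ^ j := by
          rw [hε, div_pow, one_pow]
          gcongr
          exact le_mul_of_one_le_left (by positivity) (by norm_num)
      _ ≤ (1 / 2) ^ J := pow_le_pow_of_le_one (by positivity)
          (by rw [← NNReal.coe_le_coe]; norm_num) hj
  obtain ⟨T₁, hc₁, hn₁⟩ := hT₁ ε hε0 (hεlt.trans_le (min_le_left _ _))
  obtain ⟨T₂, hc₂, hn₂⟩ := hT₂ ε hε0 (hεlt.trans_le (min_le_right _ _))
  have hεc : (ε : ℝ) = 1 / (4 * ((2 ^ j : ℕ) : ℝ)) := by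
    rw [hε]; push_cast; rfl
  have key := fun i => integral_sq_translate_sub_le K.coe_nonneg hvd hγ0 hε0 hc₁ hc₂ hn₁ hn₂ i
  rw [hεc] at key
  refine (Finset.sum_le_sum fun i _ => key i).trans (le_of_eq ?_)
  rw [Finset.sum_const, Finset.card_univ, Fintype.card_fin, nsmul_eq_mul, one_div,
    Real.inv_rpow (by positivity), ← Real.rpow_neg (by positivity),
    Real.mul_rpow (by norm_num) (by positivity)]
  push_cast
  ring

/-! ### The Sobolev index and the conclusion -/

theorem memH_zero {f : Torus2 → ℂ} (hf : MemLp f 2 torusMeasure) : MemH f 0 := by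
  simpa [MemH] using (hasSum_sq_norm_mFourierCoeff hf).summable

theorem MemH.of_le {f : Torus2 → ℂ} {r r' : ℝ} (h : MemH f r') (hr : r ≤ r') : MemH f r := by
  refine Summable.of_nonneg_of_le (fun m => ?_) (fun m => ?_) h
  · exact mul_nonneg (Real.rpow_nonneg (bracket_pos m).le _) (by positivity)
  · gcongr
    exact one_le_bracket m

theorem sobolevIndex_le_of_not_memH {f : Torus2 → ℂ} {r : ℝ} (h : ¬ MemH f r) :
    sobolevIndex f ≤ (r : EReal) := by
  refine sSup_le ?_
  rintro _ ⟨r', hr', rfl⟩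
  rw [EReal.coe_le_coe_iff]
  by_contra hlt
  exact h (MemH.of_le hr' (not_le.1 hlt).le)

theorem CoeffDecay.of_exists {f : Torus2 → ℂ} {s : ℝ}
    (h0 : ∃ C : ℝ, ∀ m, ‖UnitAddTorus.mFourierCoeff f m‖ ≤ C / bracket m ^ (1 + s))
    (h1 : ∃ C : ℝ, ∀ m, ‖diffFst f m‖ ≤ C / bracket m ^ (2 + s))
    (h2 : ∃ C : ℝ, ∀ m, ‖diffSnd f m‖ ≤ C / bracket m ^ (2 + s))
    (h3 : ∃ C : ℝ, ∀ m, ‖diffMixed f m‖ ≤ C / bracket m ^ (3 + s)) :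
    ∃ C, CoeffDecay (UnitAddTorus.mFourierCoeff f) s C := by
  obtain ⟨C₀, h0⟩ := h0
  obtain ⟨C₁, h1⟩ := h1
  obtain ⟨C₂, h2⟩ := h2
  obtain ⟨C₃, h3⟩ := h3
  have hb : ∀ (m : Fin 2 → ℤ) (e : ℝ), 0 ≤ bracket m ^ e := fun m e =>
    Real.rpow_nonneg (bracket_pos m).le e
  have n₀ := abs_nonneg C₀
  have n₁ := abs_nonneg C₁
  have n₂ := abs_nonneg C₂
  have n₃ := abs_nonneg C₃
  refine ⟨|C₀| + |C₁| + |C₂| + |C₃|, by positivity, fun m => (h0 m).trans ?_,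
    fun m => (h1 m).trans ?_, fun m => (h2 m).trans ?_, fun m => (h3 m).trans ?_⟩
  · exact div_le_div_of_nonneg_right (by linarith [le_abs_self C₀]) (hb _ _)
  · exact div_le_div_of_nonneg_right (by linarith [le_abs_self C₁]) (hb _ _)
  · exact div_le_div_of_nonneg_right (by linarith [le_abs_self C₂]) (hb _ _)
  · exact div_le_div_of_nonneg_right (by linarith [le_abs_self C₃]) (hb _ _)

/-- The lower bound for the graph dimension, for a continuous and Hölder representative. -/
theorem sub_sobolevIndex_le_graphDim {f : Torus2 → ℂ} (hf : MemLp f 2 torusMeasure) {s t : ℝ}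
    (hs : 0 < s) {v : C(Torus2, ℂ)} (hv : v =ᵐ[torusMeasure] schrodingerFlow f t)
    (hγ : ∀ γ : ℝ≥0, (γ : ℝ) < s → ∃ K : ℝ≥0, HolderWith K γ v) :
    ((3 + s : ℝ) : EReal) - 2 * sobolevIndex f ≤ graphDim v := by
  rw [← EReal.le_of_forall_lt_iff_le]
  intro D hD
  have hmem : ∀ r : ℝ, 0 ≤ r → 2 * r < s + 3 - D → MemH f r := by
    intro r hr0 hr
    have := summable_bracket_of_graphDim_lt hs hγ hD hr0 hr
    simpa only [MemH, mFourierCoeff_congr_ae hv, (hasSum_schrodingerFlow hf t).2] using this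
  -- Negative orders follow from f ∈ L² alone.
  have hmem' : ∀ r : ℝ, 2 * r < s + 3 - D → MemH f r := by
    intro r hr
    rcases le_total 0 r with h | h
    · exact hmem r h hr
    · exact (memH_zero hf).of_le h
  have hidx : (((s + 3 - D) / 2 : ℝ) : EReal) ≤ sobolevIndex f := by
    rw [← EReal.ge_of_forall_gt_iff_ge]
    intro r hr
    exact le_sSup ⟨r, hmem' r (by linarith [EReal.coe_lt_coe_iff.1 hr]), rfl⟩
  -- The index is not -∞ because it has a real lower bound; at +∞ the left side is -∞.
  induction h : sobolevIndex f with
  | bot => rw [h] at hidx; simp at hidx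
  | top =>
    rw [EReal.mul_top_of_pos (by norm_num)]
    simp
  | coe x =>
    rw [h, EReal.coe_le_coe_iff] at hidx
    have : ((3 + s : ℝ) : EReal) - 2 * (x : EReal) = ((3 + s - 2 * x : ℝ) : EReal) := by
      push_cast; rfl
    rw [this, EReal.coe_le_coe_iff]
    linarith

theorem mainTheorem10 (s : ℝ) (hs0 : 0 < s) (hs1 : s < 1)
    (f : Torus2 → ℂ) (hf : MemLp f 2 torusMeasure)
    (h0 : ∃ C : ℝ, ∀ m, ‖UnitAddTorus.mFourierCoeff f m‖ ≤ C / bracket m ^ (1 + s))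
    (h1 : ∃ C : ℝ, ∀ m, ‖diffFst f m‖ ≤ C / bracket m ^ (2 + s))
    (h2 : ∃ C : ℝ, ∀ m, ‖diffSnd f m‖ ≤ C / bracket m ^ (2 + s))
    (h3 : ∃ C : ℝ, ∀ m, ‖diffMixed f m‖ ≤ C / bracket m ^ (3 + s)) :
    (∀ᵐ t : ℝ, ∃ v : C(Torus2, ℂ), v =ᵐ[torusMeasure] schrodingerFlow f t ∧
        (∀ γ : ℝ≥0, (γ : ℝ) < s → ∃ C : ℝ≥0, HolderWith C γ v) ∧
        graphDim v ≤ ((3 - s : ℝ) : EReal)) ∧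
    (∀ᵐ t : ℝ, ∀ v : C(Torus2, ℂ), v =ᵐ[torusMeasure] schrodingerFlow f t →
        ((3 + s : ℝ) : EReal) - 2 * sobolevIndex f ≤ graphDim v) ∧
    (s = 1 / 2 → ¬ MemH f (1 / 2) →
      ∀ᵐ t : ℝ, ∃ v : C(Torus2, ℂ), v =ᵐ[torusMeasure] schrodingerFlow f t ∧
        graphDim v = ((5 / 2 : ℝ) : EReal)) := by
  obtain ⟨C, hC⟩ := CoeffDecay.of_exists h0 h1 h2 h3
  have key : ∀ᵐ t : ℝ, ∃ v : C(Torus2, ℂ), v =ᵐ[torusMeasure] schrodingerFlow f t ∧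
      ∀ γ : ℝ≥0, (γ : ℝ) < s → ∃ C : ℝ≥0, HolderWith C γ v := by
    filter_upwards [ae_forall_weylBound] with t ht
    obtain ⟨v, hv, hγ⟩ := hC.exists_tendsto_flowSum hs0 hs1 ht
    exact ⟨v, ae_eq_schrodingerFlow_of_tendsto hf hv, hγ⟩
  refine ⟨?_, ?_, ?_⟩
  · filter_upwards [key] with t ⟨v, hv, hγ⟩
    exact ⟨v, hv, hγ, graphDim_le_of_holder hs0 hs1 hγ⟩
  · filter_upwards [key] with t ⟨v, hv, hγ⟩ w hw
    -- Haar measure charges open sets, so any continuous representative is the Hölder one.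
    have hwv : (w : Torus2 → ℂ) = v :=
      (w.continuous.ae_eq_iff_eq torusMeasure v.continuous).1 (hw.trans hv.symm)
    rw [hwv]
    exact sub_sobolevIndex_le_graphDim hf hs0 hv hγ
  · intro hs hnot
    filter_upwards [key] with t ⟨v, hv, hγ⟩
    refine ⟨v, hv, le_antisymm ?_ ?_⟩
    · refine (graphDim_le_of_holder hs0 hs1 hγ).trans ?_
      rw [EReal.coe_le_coe_iff]
      linarith
    · refine le_trans ?_ (sub_sobolevIndex_le_graphDim hf hs0 hv hγ)
      have hidx := sobolevIndex_le_of_not_memH hnot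
      have h4 : 2 * sobolevIndex f ≤ ((1 : ℝ) : EReal) := by
        calc 2 * sobolevIndex f ≤ 2 * (((1 / 2 : ℝ)) : EReal) := by gcongr
          _ = ((1 : ℝ) : EReal) := by
            rw [show (2 : EReal) = ((2 : ℝ) : EReal) from rfl, ← EReal.coe_mul]
            norm_num
      calc ((5 / 2 : ℝ) : EReal) = ((3 + s : ℝ) : EReal) - ((1 : ℝ) : EReal) := by
            rw [← EReal.coe_sub, hs]; norm_num
        _ ≤ _ := EReal.sub_le_sub le_rfl h4
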